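/- All graphs are finite, may have parallel edges, have no loops, and need not be connected. A signature of $G$ is a map $\sigma:E(G)\to\{\pm1\}$, and $N_\sigma=\sigma^{-1}(-1)$. An orientation of $(G,\sigma)$ assigns to each half-edge $h_e^v$ ($v$ an end of $e$) a value $\tau(h_e^v)\in\{\pm1\}$ such that $\tau(h_e^u)\tau(h_e^v)=-\sigma(e)$ for every edge $e=uv$. For real $r\ge 2$, a nowhere-zero $r$-flow on $(G,\sigma)$ is a function $f:E(G)\to\mathbb R$ with $1\le|f(e)|\le r-1$ for all $e\in E(G)$ such that, for some orientation $\tau$ of $(G,\sigma)$, $\sum_{e\ni v}\tau(h_e^v)f(e)=0$ for every vertex $v$. Let $F_c((G,\sigma))$ be the infimum of all $r\ge2$ such that $(G,\sigma)$ admits a nowhere-zero $r$-flow, and $F((G,\sigma))$ the infimum of all $r\ge2$ such that it admits an integer-valued one (each is $\infty$ if there is no such flow). A set $X\subseteq E(G)$ is $r$-minimal if the signature $\sigma$ with $N_\sigma=X$ satisfies $F_c((G,\sigma))=r$, and $F_c((G,\sigma'))\ne r$ for every signature $\sigma'$ with $N_{\sigma'}\subsetneq X$. The oddness $\omega(G)$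 of a cubic graph $G$ with a 1-factor is the minimum number of odd circuits in a 2-factor of $G$. Theorem. Let $G$ be a non-bipartite cubic graph that has a 1-factor. Then $G$ has a signature $\sigma$ such that $|N_\sigma|=\omega(G)$ and $F_c((G,\sigma))=F((G,\sigma))=4$. Furthermore, if $G$ is bridgeless, then for every 3-minimal set $X_3$ of $G$ there is a 4-minimal set $X_4$ of $G$ with $X_4\subsetneq X_3$ and $|X_4|\le\omega(G)<|X_3|$. -/

import Mathlib

/-! Multigraphs are Mathlib's `Graph α β`; parallel edges are allowed. All graphs considered are
finite and loopless, so the degree of a vertex is the number of edges incident with it. -/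

open scoped Graph

noncomputable section

namespace Graph

variable {α β : Type*}

/-- Every vertex has degree `k` (for loopless graphs). -/
def IsRegular (G : Graph α β) (k : ℕ) : Prop :=
  ∀ v ∈ V(G), (G.incidenceSet v).encard = k

/-- `F` is a `k`-factor of `G`: a spanning `k`-regular subgraph. -/
def IsFactor (F G : Graph α β) (k : ℕ) : Prop :=
  F ≤s G ∧ F.IsRegular k

/-- The vertices have a 2-colouring for which every edge has ends of different colours. -/
def IsBipartite (G : Graph α β) : Prop :=
  ∃ c : α → Bool, ∀ e x y, G.IsLink e x y → c x ≠ c y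

/-- There is a walk from `x` to `y`. -/
def Reachable (G : Graph α β) (x y : α) : Prop :=
  Relation.ReflTransGen G.Adj x y

def IsConnected (G : Graph α β) : Prop :=
  V(G).Nonempty ∧ ∀ x ∈ V(G), ∀ y ∈ V(G), G.Reachable x y

/-- A bridge is an edge whose deletion disconnects its ends. -/
def IsBridge (G : Graph α β) (e : β) : Prop :=
  ∃ x y, G.IsLink e x y ∧ ¬ (G.deleteEdges {e}).Reachable x y

def IsBridgeless (G : Graph α β) : Prop :=
  ∀ e, ¬ G.IsBridge e

/-- A circuit is a connected 2-regular graph; two parallel edges form a circuit of length 2. -/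
def IsCircuit (C : Graph α β) : Prop :=
  C.IsConnected ∧ C.IsRegular 2

/-- The circuits of odd length contained in `F`. -/
def oddCircuits (F : Graph α β) : Set (Graph α β) :=
  {C | C ≤ F ∧ C.IsCircuit ∧ Odd E(C).ncard}

/-- The minimum number of odd circuits of a 2-factor of `G`. -/
def oddness (G : Graph α β) : ℕ :=
  sInf {n | ∃ F : Graph α β, F.IsFactor G 2 ∧ F.oddCircuits.ncard = n}

/-- The negative edges of the signature `σ`; only the values of `σ` on `E(G)` matter. -/
def negEdges (G : Graph α β) (σ : β → ℤˣ) : Set β :=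
  {e ∈ E(G) | σ e = -1}

/-- `τ e v` is the direction of the half-edge of `e` at `v` (`1` outgoing, `-1` incoming); only the
values at incident pairs matter. -/
def IsOrientation (G : Graph α β) (σ : β → ℤˣ) (τ : β → α → ℤˣ) : Prop :=
  ∀ e x y, G.IsLink e x y → τ e x * τ e y = - σ e

/-- The boundary of `f` at the vertex `v` with respect to the orientation `τ`. -/
def boundary (G : Graph α β) (τ : β → α → ℤˣ) (f : β → ℝ) (v : α) : ℝ :=
  ∑ᶠ e ∈ G.incidenceSet v, ((τ e v : ℤ) : ℝ) * f e

/-- `f` is an `r`-flow with respect to the orientation `τ`. -/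
def IsFlow (G : Graph α β) (τ : β → α → ℤˣ) (r : ℝ) (f : β → ℝ) : Prop :=
  (∀ e ∈ E(G), |f e| ∈ Set.Icc 1 (r - 1) ∪ {0}) ∧ ∀ v ∈ V(G), G.boundary τ f v = 0

/-- `f` is a nowhere-zero `r`-flow on `(G, σ)` with respect to some orientation of `(G, σ)`. -/
def IsNowhereZeroFlow (G : Graph α β) (σ : β → ℤˣ) (r : ℝ) (f : β → ℝ) : Prop :=
  (∃ τ, G.IsOrientation σ τ ∧ G.IsFlow τ r f) ∧ ∀ e ∈ E(G), f e ≠ 0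

/-- The circular flow number of `(G, σ)`; it is `⊤` if there is no nowhere-zero flow. -/
def circularFlowNumber (G : Graph α β) (σ : β → ℤˣ) : EReal :=
  sInf ((fun r : ℝ => (r : EReal)) '' {r | 2 ≤ r ∧ ∃ f, G.IsNowhereZeroFlow σ r f})

/-- The integer flow number of `(G, σ)`; it is `⊤` if there is no nowhere-zero integer flow. -/
def integerFlowNumber (G : Graph α β) (σ : β → ℤˣ) : EReal :=
  sInf ((fun r : ℝ => (r : EReal)) '' {r | 2 ≤ r ∧
    ∃ f, G.IsNowhereZeroFlow σ r f ∧ ∀ e ∈ E(G), ∃ n : ℤ, f e = n})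

/-- `X` is `r`-minimal: some signature with negative edge set `X` has circular flow number `r`, and
no signature whose negative edge set is a proper subset of `X` does. -/
def IsMinimalSet (G : Graph α β) (r : ℝ) (X : Set β) : Prop :=
  (∃ σ, G.circularFlowNumber σ = r ∧ G.negEdges σ = X) ∧
    ∀ σ', G.negEdges σ' ⊂ X → G.circularFlowNumber σ' ≠ r

end Graph

end

/-! ### Common 2-colourings of two involutions -/

section

open Equiv Function

/-! The key notion is antibalance: switching turns the signature into the all-negative one. In a
nowhere-zero r-flow with r < 4 on a cubic graph, each vertex has exactly one edge of absolute value
at least 2, and its signed value is opposite to the other two. The sign of that edge defines the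
switching (`IsNowhereZeroFlow.isAntibalanced`). Conversely, 1 on a 2-factor and 2 on the
complementary matching give a 3-flow (`IsAntibalanced.circularFlowNumber_eq`). So the circular flow
number is 3 for antibalanced signatures and at least 4 for all others.

Take a 2-factor with ω(G) odd circuits and make one edge of each odd circuit negative. Every such
choice has an integer 4-flow, with 2 on the matching and ±1 or ±3 on the circuits
(`exists_isNowhereZeroFlow`), so the value is 4 unless the choice is antibalanced. If all choices
were antibalanced, moving a negative edge past a vertex v would show that a union of circuits hangs
on the rest of G by the matching edge at v alone. A parity descent (`not_odd_of_pendant`) then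
excludes odd circuits altogether, and G would be bipartite.

For a 3-minimal set X₃ the signature is antibalanced, so X₃ meets every odd circuit. By Tutte's
theorem some 2-factor avoids a given edge of X₃, whence ω(G) < |X₃|. One edge of X₃ from each odd
circuit of an optimal 2-factor forms a proper subset of X₃. It is not antibalanced by minimality, so
it has flow number 4, and it contains a 4-minimal set. -/

/-- Two fixed-point-free involutions admit a common proper 2-colouring. -/
lemma exists_coloring_of_involutive {D : Type*} {a b : D → D} (ha : Involutive a)
    (hb : Involutive b) (ha' : ∀ d, a d ≠ d) (hb' : ∀ d, b d ≠ d) :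
    ∃ c : D → Bool, ∀ d, c (a d) ≠ c d ∧ c (b d) ≠ c d := by
  classical
  let A : Perm D := ha.toPerm
  let B : Perm D := hb.toPerm
  have hA : A * A = 1 := Equiv.ext ha
  have hB : B * B = 1 := Equiv.ext hb
  have hBi : B⁻¹ = B := inv_eq_of_mul_eq_one_left hB
  have hAi : A⁻¹ = A := inv_eq_of_mul_eq_one_left hA
  have hconj : B * (A * B) * B⁻¹ = (A * B)⁻¹ := by
    rw [mul_inv_rev, hAi, hBi, mul_assoc, mul_assoc, hB, mul_one]
  have hcomm (i : ℤ) : B * (A * B) ^ i = (A * B) ^ (-i) * B := by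
    rw [zpow_neg, ← inv_zpow, ← hconj, conj_zpow, inv_mul_cancel_right]
  set π : Perm D := A * B with hπ
  have hcomm' (i : ℤ) (d : D) : B ((π ^ i) d) = (π ^ (-i)) (B d) :=
    congrArg (fun f : Perm D => f d) (hcomm i)
  -- If `π ^ i` takes `d` to `B d`, the midpoint of this path is a fixed point of `B` for even `i`
  -- and of `A` for odd `i`.
  have key (d : D) : ¬ π.SameCycle d (B d) := by
    rintro ⟨i, hi⟩
    obtain ⟨j, rfl | rfl⟩ := i.even_or_odd'
    · apply hb' ((π ^ j) d)
      change B _ = _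
      rw [hcomm', ← hi, ← Perm.mul_apply, ← zpow_add]
      congr 2; ring
    · apply ha' (B ((π ^ j) d))
      change π ((π ^ j) d) = _
      rw [hcomm', ← hi, ← Perm.mul_apply, ← Perm.mul_apply, ← zpow_add, ← zpow_one_add]
      congr 2; ring
  have hBB (d : D) : B (B d) = d := hb d
  have hflip {x y : D} (h : π.SameCycle x y) : π.SameCycle (B x) (B y) := by
    obtain ⟨i, rfl⟩ := h
    exact ⟨-i, (hcomm' i x).symm⟩
  -- The orbits of the dihedral group generated by `A` and `B`. Each consists of two `π`-cycles
  -- swapped by both involutions, and these are the colour classes.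
  let S : Setoid D :=
    { r := fun d e => π.SameCycle d e ∨ π.SameCycle (B d) e
      iseqv :=
        { refl := fun d => Or.inl (Perm.SameCycle.refl _ _)
          symm := by
            rintro x y (h | h)
            · exact Or.inl h.symm
            · right
              have := hflip h.symm
              rwa [hBB] at this
          trans := by
            rintro x y z (h | h) (h' | h')
            · exact Or.inl (h.trans h')
            · exact Or.inr ((hflip h).trans h')
            · exact Or.inr (h.trans h')
            · left
              have := hflip h
              rw [hBB] at this
              exact this.trans h' } }
  let rep : D → D := fun d => (Quotient.mk S d).out
  have hrep (d : D) : π.SameCycle (rep d) d ∨ π.SameCycle (B (rep d)) d :=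
    Quotient.mk_out (s := S) d
  have hrepB (d : D) : rep (B d) = rep d :=
    congrArg Quotient.out (Quotient.sound (s := S) (Or.inr (by rw [hBB])))
  have hAd (d : D) : a d = π (B d) := congrArg A (hBB d).symm
  have hrepA (d : D) : rep (a d) = rep d := by
    rw [← hrepB d]
    refine congrArg Quotient.out (Quotient.sound (s := S) (Or.inl ?_))
    rw [hAd]
    exact Perm.sameCycle_apply_left.2 (Perm.SameCycle.refl _ _)
  have hmain (d : D) : π.SameCycle (rep d) (B d) ↔ ¬ π.SameCycle (rep d) d := by
    constructor
    · intro h h'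
      exact key d (h'.symm.trans h)
    · intro h
      have := hflip ((hrep d).resolve_left h)
      rwa [hBB] at this
  refine ⟨fun d => decide (π.SameCycle (rep d) d), fun d => ⟨?_, ?_⟩⟩
  · simp only [hrepA]
    rw [hAd, ne_eq, decide_eq_decide, Perm.sameCycle_apply_right, hmain]
    tauto
  · change decide (π.SameCycle (rep (B d)) (B d)) ≠ _
    rw [hrepB, ne_eq, decide_eq_decide, hmain]
    tauto

/-- A colouring of a matching `b` together with a partial matching `a`, given as an involution with
possible fixed points. -/
lemma exists_coloring_of_partial_involutive {D : Type*} {a b : D → D} (ha : Involutive a)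
    (hb : Involutive b) (hb' : ∀ d, b d ≠ d) :
    ∃ c : D → Bool, ∀ d, (a d ≠ d → c (a d) ≠ c d) ∧ c (b d) ≠ c d := by
  classical
  -- Take two copies of `D` and match each fixed point of `a` with its twin, so that no fixed points
  -- remain.
  obtain ⟨c, hc⟩ := exists_coloring_of_involutive (D := D × Bool)
    (a := fun p => if a p.1 = p.1 then (p.1, !p.2) else (a p.1, p.2))
    (b := fun p => (b p.1, p.2))
    (by
      rintro ⟨d, i⟩
      by_cases h : a d = d
      · simp [h]
      · have h' : ¬ d = a d := fun h' => h h'.symm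
        simp [h, h', ha d])
    (by rintro ⟨d, i⟩; simp [hb d])
    (by
      rintro ⟨d, i⟩
      by_cases h : a d = d <;> simp [h])
    (by rintro ⟨d, i⟩; simp [hb' d])
  refine ⟨fun d => c (d, false), fun d => ⟨fun h => ?_, (hc (d, false)).2⟩⟩
  have := (hc (d, false)).1
  simpa [h] using this

/-! ### Cycles of a permutation: parity, base points, pendant sets -/

namespace Equiv.Perm

variable {V : Type*}

lemma minimalPeriod_pos [Finite V] (ρ : Perm V) (v : V) : 0 < minimalPeriod ρ v :=
  minimalPeriod_pos_of_mem_periodicPts (ρ.injective.mem_periodicPts v)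

lemma SameCycle.exists_iterate_lt [Finite V] {ρ : Perm V} {u v : V} (h : ρ.SameCycle u v) :
    ∃ k < minimalPeriod ρ u, ρ^[k] u = v := by
  obtain ⟨i, rfl⟩ := h.exists_nat_pow_eq
  refine ⟨i % minimalPeriod ρ u, Nat.mod_lt _ (minimalPeriod_pos ρ u), ?_⟩
  rw [iterate_mod_minimalPeriod_eq, coe_pow]

lemma sameCycle_iterate (ρ : Perm V) (k : ℕ) (v : V) : ρ.SameCycle v (ρ^[k] v) :=
  ⟨k, by rw [zpow_natCast, coe_pow]⟩

lemma SameCycle.minimalPeriod_eq {ρ : Perm V} [Finite V] {u v : V} (h : ρ.SameCycle u v) :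
    minimalPeriod ρ u = minimalPeriod ρ v := by
  obtain ⟨k, -, rfl⟩ := h.exists_iterate_lt
  rw [minimalPeriod_apply_iterate (ρ.injective.mem_periodicPts u)]

/-- If a colouring is flipped along every step of a cycle, then the cycle is even. -/
lemma even_minimalPeriod_of_flip [Finite V] {ρ : Perm V} {v : V} {s : V → Bool}
    (h : ∀ u, ρ.SameCycle v u → s (ρ u) ≠ s u) : Even (minimalPeriod ρ v) := by
  have key (k : ℕ) : s (ρ^[k] v) = (s v ^^ decide (Odd k)) := by
    induction k with
    | zero => simp
    | succ k ih =>
      have := h _ (sameCycle_iterate ρ k v)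
      rw [iterate_succ_apply', Bool.eq_not.2 this, ih]
      by_cases hk : Odd k <;> simp [hk, Nat.odd_add_one]
  have h1 := key (minimalPeriod ρ v)
  rw [iterate_minimalPeriod] at h1
  by_contra h2
  rw [Nat.not_even_iff_odd] at h2
  simp [h2] at h1

/-- A function constant along all steps of the cycle of `v` not at `v` is constant off `v`. -/
lemma eq_of_constant_off [Finite V] {γ : Type*} {ρ : Perm V} {v : V} {t : V → γ}
    (h : ∀ u, ρ.SameCycle v u → u ≠ v → ρ u ≠ v → t (ρ u) = t u) {x : V}
    (hx : ρ.SameCycle v x) (hxv : x ≠ v) : t x = t (ρ v) := by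
  obtain ⟨k, hk, rfl⟩ := hx.exists_iterate_lt
  have key (j : ℕ) (hj : j + 1 < minimalPeriod ρ v) : t (ρ^[j + 1] v) = t (ρ v) := by
    induction j with
    | zero => rfl
    | succ j ih =>
      rw [← ih (by omega), iterate_succ_apply' ρ (j + 1)]
      have hne (i : ℕ) (hi : i ≠ 0) (hi' : i < minimalPeriod ρ v) : ρ^[i] v ≠ v :=
        not_isPeriodicPt_of_pos_of_lt_minimalPeriod hi hi'
      apply h _ (sameCycle_iterate _ _ _) (hne _ (by omega) (by omega))
      rw [← iterate_succ_apply' ρ]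
      exact hne _ (by omega) hj
  cases k with
  | zero => exact absurd rfl hxv
  | succ k => exact key k hk

/-- `b` chooses a base point in every cycle of `ρ`. -/
structure IsBase (ρ : Perm V) (b : V → V) : Prop where
  sameCycle : ∀ v, ρ.SameCycle v (b v)
  eq_of_sameCycle : ∀ u v, ρ.SameCycle u v → b u = b v

/-- The last clause fixes a default independent of `P`, so that bases built from different `P` agree
on every cycle that meets neither. -/
lemma exists_isBase (ρ : Perm V) (P : V → Prop) :
    ∃ b, ρ.IsBase b ∧ (∀ v, (∃ u, ρ.SameCycle v u ∧ P u) → P (b v)) ∧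
      ∀ v, (¬ ∃ u, ρ.SameCycle v u ∧ P u) → b v = (Quotient.mk (SameCycle.setoid ρ) v).out := by
  classical
  let g : Quotient (SameCycle.setoid ρ) → V := fun q =>
    if h : ∃ u, Quotient.mk (SameCycle.setoid ρ) u = q ∧ P u then h.choose else q.out
  have hex (v : V) : (∃ u, Quotient.mk (SameCycle.setoid ρ) u = Quotient.mk _ v ∧ P u) ↔
      ∃ u, ρ.SameCycle v u ∧ P u := by
    refine exists_congr fun u => and_congr_left fun _ => ?_
    rw [Quotient.eq]
    exact sameCycle_comm
  refine ⟨fun v => g (Quotient.mk _ v), ⟨fun v => ?_, fun u v h => ?_⟩, fun v h => ?_, fun v h => ?_⟩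
  · by_cases h : ∃ u, Quotient.mk (SameCycle.setoid ρ) u = Quotient.mk _ v ∧ P u
    · simp only [g, dif_pos h]
      exact (Quotient.exact h.choose_spec.1).symm
    · simp only [g, dif_neg h]
      exact (Quotient.mk_out (s := SameCycle.setoid ρ) v).symm
  · exact congrArg g (Quotient.sound h)
  · rw [← hex] at h
    simp only [g, dif_pos h]
    exact h.choose_spec.2
  · rw [← hex] at h
    simp only [g, dif_neg h]

namespace IsBase

variable {ρ : Perm V} {b : V → V}

lemma base_base (h : ρ.IsBase b) (v : V) : b (b v) = b v :=
  (h.eq_of_sameCycle _ _ (h.sameCycle v)).symm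

lemma base_apply (h : ρ.IsBase b) (v : V) : b (ρ v) = b v :=
  h.eq_of_sameCycle _ _ (sameCycle_apply_left.2 (SameCycle.refl _ _))

/-- Each cycle can be coloured alternately, starting with `false` at the base point. -/
lemma exists_alternating [Finite V] (h : ρ.IsBase b) :
    ∃ p : V → Bool, (∀ v, b v = v → p v = false) ∧ (∀ v, b (ρ v) ≠ ρ v → p (ρ v) = !p v) ∧
      ∀ v, b (ρ v) = ρ v → (p v = true ↔ Even (minimalPeriod ρ v)) := by
  classical
  have hex (v : V) : ∃ k < minimalPeriod ρ v, ρ^[k] (b v) = v := by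
    have := (h.sameCycle v).symm.exists_iterate_lt
    rwa [← (h.sameCycle v).minimalPeriod_eq] at this
  choose k hk hkv using hex
  have huniq (v : V) (j : ℕ) (hj : j < minimalPeriod ρ v) (hjv : ρ^[j] (b v) = v) : k v = j := by
    have h1 := iterate_eq_iterate_iff_of_lt_minimalPeriod (f := ρ) (x := b v) (m := k v) (n := j)
      (by rw [← (h.sameCycle v).minimalPeriod_eq]; exact hk v)
      (by rw [← (h.sameCycle v).minimalPeriod_eq]; exact hj)
    exact h1.1 ((hkv v).trans hjv.symm)
  have hper (v : V) : minimalPeriod ρ (ρ v) = minimalPeriod ρ v :=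
    (sameCycle_apply_left.2 (SameCycle.refl ρ v)).minimalPeriod_eq
  have hk0 (v : V) (hv : b v = v) : k v = 0 := huniq v 0 (minimalPeriod_pos ρ v) hv
  have hstep (v : V) : ρ^[k v + 1] (b (ρ v)) = ρ v := by
    rw [h.base_apply, iterate_succ_apply', hkv]
  refine ⟨fun v => decide (Odd (k v)), fun v hv => by simp [hk0 v hv], fun v hv => ?_,
    fun v hv => ?_⟩
  · have hlt : k v + 1 < minimalPeriod ρ v := by
      refine lt_of_le_of_ne (hk v) fun heq => hv ?_
      have := hstep v
      rw [heq, ← hper, (h.sameCycle (ρ v)).minimalPeriod_eq, iterate_minimalPeriod] at this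
      exact this
    have : k (ρ v) = k v + 1 := huniq _ _ (by rwa [hper]) (hstep v)
    by_cases hkv : Odd (k v) <;> simp [this, hkv, Nat.odd_add_one]
  · have heq : k v + 1 = minimalPeriod ρ v := by
      by_contra hne
      have : k (ρ v) = k v + 1 :=
        huniq _ _ (by rw [hper]; have := hk v; omega) (hstep v)
      rw [hk0 _ hv] at this
      omega
    rw [← heq, decide_eq_true_eq, Nat.even_add_one, Nat.not_even_iff_odd]

end IsBase

/-- A set of odd size closed under `ρ` contains an odd cycle. -/
lemma exists_odd_minimalPeriod [Finite V] (ρ : Perm V) {A : Set V}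
    (hA : ∀ x, x ∈ A ↔ ρ x ∈ A) (hodd : Odd A.ncard) :
    ∃ x ∈ A, Odd (minimalPeriod ρ x) := by
  classical
  have := Fintype.ofFinite V
  -- The power `ρ ^ q` acts on `A` with order dividing `2 ^ n`, so its number of fixed points is
  -- congruent to `|A|` modulo 2. A fixed point has period dividing the odd number `q`.
  obtain ⟨n, q, hq, hn⟩ := Nat.exists_eq_two_pow_mul_odd (orderOf_pos ρ).ne'
  have hcl (j : ℕ) (x : V) : x ∈ A → (ρ ^ j) x ∈ A := by
    intro hx
    induction j with
    | zero => simpa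
    | succ j ih => rw [pow_succ', mul_apply]; exact (hA _).1 ih
  let f : Function.End A := fun x => ⟨(ρ ^ q) x, hcl _ _ x.2⟩
  have hf (j : ℕ) (x : A) : ((f ^ j) x : V) = (ρ ^ (q * j)) x := by
    induction j with
    | zero => simp; rfl
    | succ j ih =>
      rw [pow_succ', Nat.mul_succ, add_comm, pow_add, mul_apply, ← ih]
      rfl
  have hf1 : f ^ 2 ^ n = 1 := by
    funext x
    apply Subtype.ext
    rw [hf, mul_comm, ← hn, pow_orderOf_eq_one]
    rfl
  have hmod := card_fixedPoints_modEq hf1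
  rw [← Nat.card_eq_fintype_card, Nat.card_coe_set_eq] at hmod
  have hpos : 0 < Fintype.card f.fixedPoints := by
    rw [Nat.pos_iff_ne_zero]
    intro h0
    rw [h0] at hmod
    exact (Nat.not_even_iff_odd.2 hodd) (Nat.even_iff.2 hmod)
  obtain ⟨x⟩ := Fintype.card_pos_iff.1 hpos
  refine ⟨x.1, x.1.2, ?_⟩
  have hx : IsPeriodicPt ρ q x.1.1 := by
    have := congrArg Subtype.val x.2
    change (ρ ^ q) x.1.1 = x.1.1 at this
    rwa [coe_pow] at this
  exact Odd.of_dvd_nat hq hx.minimalPeriod_dvd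

end Equiv.Perm

/-- A set preserved by a fixed-point-free involution has even size. -/
lemma even_ncard_of_involutive {V : Type*} [Finite V] {μ : V → V} (hμ : Involutive μ)
    (hμ' : ∀ v, μ v ≠ v) {A : Set V} (hA : ∀ x ∈ A, μ x ∈ A) : Even A.ncard := by
  by_contra h
  rw [Nat.not_even_iff_odd] at h
  obtain ⟨x, -, hx⟩ := Perm.exists_odd_minimalPeriod hμ.toPerm
    (fun x => ⟨hA x, fun hx => by simpa [hμ x] using hA _ hx⟩) h
  have h2 : minimalPeriod hμ.toPerm x ∣ 2 := IsPeriodicPt.minimalPeriod_dvd (hμ x)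
  obtain h1 | h1 := (Nat.dvd_prime Nat.prime_two).1 h2
  · exact hμ' x (minimalPeriod_eq_one_iff_isFixedPt.1 h1)
  · rw [h1] at hx
    exact absurd hx (by decide)

/-- If every vertex `v` of an odd cycle of `ρ` has a set attached to the rest only through
the matching edge from `v` to `μ v`, then there is no odd cycle. -/
lemma Equiv.Perm.not_odd_of_pendant {V : Type*} [Finite V] {ρ : Perm V} {μ : V → V}
    (hρ : ∀ v, ρ v ≠ v) (hμ : Involutive μ) (hμ' : ∀ v, μ v ≠ v)
    (h : ∀ v, Odd (minimalPeriod ρ v) → ∃ A : Set V, (∀ x, x ∈ A ↔ ρ x ∈ A) ∧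
      (∀ x, ρ.SameCycle v x → x ∉ A) ∧ μ v ∈ A ∧ ∀ x ∈ A, x ≠ μ v → μ x ∈ A) (v : V) :
    ¬ Odd (minimalPeriod ρ v) := by
  classical
  choose! P hPρ hPd hPv hPμ using h
  -- Descent on a union `A` of cycles that the matching leaves only at `y`. The matching pairs off
  -- `A \ {y}`, so `A` is odd and contains an odd cycle.
  have claim : ∀ (n : ℕ) (A : Set V), A.ncard = n → (∀ x, x ∈ A ↔ ρ x ∈ A) →
      ∀ y ∈ A, μ y ∉ A → (∀ x ∈ A, x ≠ y → μ x ∈ A) → False := by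
    intro n
    induction n using Nat.strong_induction_on with
    | _ n ih =>
      intro A hn hAρ y hy hyA hA
      have hodd : Odd A.ncard := by
        have : Even (A \ {y}).ncard := by
          refine even_ncard_of_involutive hμ hμ' fun x hx => ⟨hA x hx.1 hx.2, ?_⟩
          rintro rfl
          rw [hμ x] at hyA
          exact hyA hx.1
        rw [← Set.ncard_sdiff_singleton_add_one hy]
        exact this.add_one
      obtain ⟨x, hxA, hx⟩ := ρ.exists_odd_minimalPeriod hAρ hodd
      have hcyc (u : V) (hu : ρ.SameCycle x u) : u ∈ A := by
        obtain ⟨k, -, rfl⟩ := hu.exists_iterate_lt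
        clear hu
        induction k with
        | zero => exact hxA
        | succ k ihk => rw [iterate_succ_apply']; exact (hAρ _).1 ihk
      have hper (u : V) (hu : ρ.SameCycle x u) : Odd (minimalPeriod ρ u) := by
        rwa [← hu.minimalPeriod_eq]
      -- Otherwise `A ∩ P u` is a smaller set of the same kind, left only at `μ u`.
      have hstep (u : V) (hu : ρ.SameCycle x u) (huy : u ≠ y) : y ∈ P u := by
        by_contra hyu
        have hou := hper u hu
        refine ih (A ∩ P u).ncard ?_ (A ∩ P u) rfl
          (fun z => and_congr (hAρ z) (hPρ u hou z)) (μ u) ⟨hA u (hcyc u hu) huy, hPv u hou⟩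
          (fun hz => ?_) fun z hz hzu => ⟨hA z hz.1 ?_, hPμ u hou z hz.2 hzu⟩
        · rw [← hn]
          exact Set.ncard_lt_ncard ⟨Set.inter_subset_left, fun hsub =>
            hPd u hou u (Perm.SameCycle.refl _ _) (hsub (hcyc u hu)).2⟩
        · rw [hμ u] at hz
          exact hPd u hou u (Perm.SameCycle.refl _ _) hz.2
        · rintro rfl
          exact hyu hz.2
      -- An odd cycle without fixed points has at least three vertices, so two of them differ from
      -- `y`. As `y` lies in both `P u` and `P w`, the set `A ∩ (P u \ P w)` misses `y`; it is left
      -- only at `μ u`, and it is smaller because it misses `w`.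
      obtain ⟨u, w, hu, hw, huw, huy, hwy⟩ : ∃ u w, ρ.SameCycle x u ∧ ρ.SameCycle x w ∧ u ≠ w ∧
          u ≠ y ∧ w ≠ y := by
        have h0 := Perm.SameCycle.refl ρ x
        have h1 := Perm.sameCycle_iterate ρ 1 x
        have h2 := Perm.sameCycle_iterate ρ 2 x
        simp only [iterate_succ_apply', iterate_zero_apply] at h1 h2
        have h02 : x ≠ ρ (ρ x) := by
          intro h
          have hd : minimalPeriod ρ x ∣ 2 := IsPeriodicPt.minimalPeriod_dvd h.symm
          obtain h' | h' := (Nat.dvd_prime Nat.prime_two).1 hd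
          · exact hρ x (minimalPeriod_eq_one_iff_isFixedPt.1 h')
          · rw [h'] at hx
            exact absurd hx (by decide)
        by_cases hxy : x = y
        · subst hxy
          exact ⟨_, _, h1, h2, (hρ _).symm, hρ x, h02.symm⟩
        by_cases hxy' : ρ x = y
        · subst hxy'
          exact ⟨_, _, h0, h2, h02, hxy, hρ _⟩
        · exact ⟨_, _, h0, h1, (hρ _).symm, hxy, hxy'⟩
      have hou := hper u hu
      have how := hper w hw
      have hwu : w ∉ P u := hPd u hou w (hu.symm.trans hw)
      have huw' : u ∉ P w := hPd w how u (hw.symm.trans hu)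
      refine ih (A ∩ (P u \ P w)).ncard ?_ (A ∩ (P u \ P w)) rfl
        (fun z => and_congr (hAρ z) (and_congr (hPρ u hou z) (not_congr (hPρ w how z))))
        (μ u) ⟨hA u (hcyc u hu) huy, hPv u hou, fun hz => ?_⟩ (fun hz => ?_)
        fun z hz hzu => ⟨hA z hz.1 ?_, hPμ u hou z hz.2.1 hzu, fun hz' => ?_⟩
      · rw [← hn]
        exact Set.ncard_lt_ncard ⟨Set.inter_subset_left, fun hsub =>
          hwu (hsub (hcyc w hw)).2.1⟩
      · have := hPμ w how _ hz (fun h => huw (hμ.injective h))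
        rw [hμ u] at this
        exact huw' this
      · rw [hμ u] at hz
        exact hPd u hou u (Perm.SameCycle.refl _ _) hz.2.1
      · rintro rfl
        exact hz.2.2 (hstep w hw hwy)
      · by_cases hzw : z = w
        · exact hwu (hzw ▸ hz.2.1)
        · have := hPμ w how _ hz' (fun h => hzw (hμ.injective h))
          rw [hμ z] at this
          exact hz.2.2 this
  intro hv
  refine claim _ (P v) rfl (hPρ v hv) (μ v) (hPv v hv) ?_ (hPμ v hv)
  rw [hμ v]
  exact hPd v hv v (Perm.SameCycle.refl _ _)

end

/-! ### Traversing a 2-factor of a cubic graph -/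

noncomputable section

open Equiv Function

namespace Graph

variable {α β : Type*}

/-- A 2-regular graph can be traversed by a permutation of its vertices. -/
lemma IsRegular.exists_next {F : Graph α β} [F.Loopless] {W : Set α} (hW : V(F) = W)
    (hfin : W.Finite) (hF : F.IsRegular 2) :
    ∃ (next : Perm W) (out : W → β), (∀ v, F.IsLink (out v) v (next v)) ∧ Injective out ∧
      ∀ e ∈ E(F), ∃ v, out v = e := by
  classical
  subst hW
  have : Finite V(F) := hfin
  -- Half-edges, with one involution moving to the other end of the edge and the other to the second
  -- edge at the vertex. A common 2-colouring orients every circuit consistently.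
  let D := {p : β × V(F) // F.Inc p.1 p.2}
  have hother (d : D) : ∃ y : V(F), F.IsLink d.1.1 d.1.2 y := by
    obtain ⟨y, hy⟩ := d.2
    exact ⟨⟨y, hy.right_mem⟩, hy⟩
  choose oth hoth using hother
  have hswap (d : D) : ∃ e, F.Inc e d.1.2 ∧ e ≠ d.1.1 ∧
      ∀ e', F.Inc e' d.1.2 → e' ≠ d.1.1 → e' = e := by
    obtain ⟨a, b, hab, h⟩ := Set.encard_eq_two.1 (hF d.1.2 d.1.2.2)
    have hmem (e : β) : F.Inc e d.1.2 ↔ e = a ∨ e = b := by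
      rw [← mem_incidenceSet, h]; simp
    rcases (hmem _).1 d.2 with h1 | h1
    · refine ⟨b, (hmem b).2 (Or.inr rfl), h1 ▸ hab.symm, fun e' he' hne => ?_⟩
      exact ((hmem e').1 he').resolve_left (h1 ▸ hne)
    · refine ⟨a, (hmem a).2 (Or.inl rfl), h1 ▸ hab, fun e' he' hne => ?_⟩
      exact ((hmem e').1 he').resolve_right (h1 ▸ hne)
  choose sw hswi hswne hswu using hswap
  let flip : D → D := fun d => ⟨(d.1.1, oth d), (hoth d).inc_right⟩
  let swap : D → D := fun d => ⟨(sw d, d.1.2), hswi d⟩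
  have hflip : Involutive flip := by
    intro d
    apply Subtype.ext
    refine Prod.ext rfl (Subtype.ext ?_)
    exact ((hoth (flip d)).right_unique (hoth d).symm)
  have hswap : Involutive swap := by
    intro d
    apply Subtype.ext
    refine Prod.ext ?_ rfl
    exact (hswu (swap d) d.1.1 d.2 (hswne d).symm).symm
  obtain ⟨c, hc⟩ := exists_coloring_of_involutive hflip hswap
    (fun d h => (hoth d).ne.symm (congrArg (fun d : D => (d.1.2 : α)) h))
    (fun d h => hswne d (congrArg (fun d : D => d.1.1) h))
  have hcu (d d' : D) (h : d.1.2 = d'.1.2) (hcd : c d = c d') : d = d' := by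
    by_contra hne
    have h1 : d = swap d' := by
      apply Subtype.ext
      refine Prod.ext ?_ h
      refine hswu d' d.1.1 (h ▸ d.2) fun h2 => hne (Subtype.ext (Prod.ext h2 h))
    exact (hc d').2 (h1 ▸ hcd)
  have hcf (d d' : D) (h : d.1.1 = d'.1.1) (hcd : c d = c d') : d = d' := by
    by_contra hne
    have h1 : d = flip d' := by
      apply Subtype.ext
      refine Prod.ext h (Subtype.ext ?_)
      have h3 : F.Inc d'.1.1 d.1.2 := h ▸ d.2
      refine (h3.eq_or_eq_of_isLink (hoth d')).resolve_left fun h2 => ?_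
      exact hne (Subtype.ext (Prod.ext h (Subtype.ext h2)))
    exact (hc d').1 (h1 ▸ hcd)
  have hex (v : V(F)) : ∃ d : D, d.1.2 = v ∧ c d = true := by
    obtain ⟨a, b, hab, h⟩ := Set.encard_eq_two.1 (hF v v.2)
    have ha : F.Inc a v := by rw [← mem_incidenceSet, h]; simp
    let d : D := ⟨(a, v), ha⟩
    by_cases hd : c d = true
    · exact ⟨d, rfl, hd⟩
    · refine ⟨swap d, rfl, ?_⟩
      have := (hc d).2
      rw [Bool.not_eq_true] at hd
      rwa [hd, ne_eq, Bool.not_eq_false] at this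
  choose d hdv hdc using hex
  have hinj : Injective fun v => oth (d v) := by
    intro u v huv
    have h1 : flip (d u) = flip (d v) := by
      refine hcu _ _ huv ?_
      have hu := (hc (d u)).1
      have hv := (hc (d v)).1
      rw [hdc, ne_eq, Bool.not_eq_true] at hu hv
      rw [hu, hv]
    rw [← hdv u, ← hdv v, hflip.injective h1]
  refine ⟨Equiv.ofBijective _ (Finite.injective_iff_bijective.1 hinj), fun v => (d v).1.1,
    fun v => ?_, fun u v huv => ?_, fun e he => ?_⟩
  · have := hoth (d v)
    rw [hdv] at this
    exact this
  · rw [← hdv u, ← hdv v, hcf (d u) (d v) huv (by rw [hdc, hdc])]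
  · obtain ⟨x, y, hxy⟩ := exists_isLink_of_mem_edgeSet he
    let d0 : D := ⟨(e, ⟨x, hxy.left_mem⟩), hxy.inc_left⟩
    have hkey : ∃ d1 : D, d1.1.1 = e ∧ c d1 = true := by
      by_cases h : c d0 = true
      · exact ⟨d0, rfl, h⟩
      · refine ⟨flip d0, rfl, ?_⟩
        have := (hc d0).1
        rw [Bool.not_eq_true] at h
        rwa [h, ne_eq, Bool.not_eq_false] at this
    obtain ⟨d1, h1, h2⟩ := hkey
    refine ⟨d1.1.2, ?_⟩
    change (d d1.1.2).1.1 = e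
    rw [hcu (d d1.1.2) d1 (hdv _) (by rw [hdc, h2]), h1]

/-- A traversal of a 2-factor `F` of `G` together with the complementary matching. -/
structure Frame (G F : Graph α β) where
  next : Perm V(G)
  out : V(G) → β
  mate : V(G) → V(G)
  cross : V(G) → β
  le : F ≤ G
  out_link : ∀ v, F.IsLink (out v) v (next v)
  out_injective : Injective out
  out_surjective : ∀ e ∈ E(F), ∃ v, out v = e
  cross_link : ∀ v, G.IsLink (cross v) v (mate v)
  cross_notMem : ∀ v, cross v ∉ E(F)
  cross_eq : ∀ e, e ∉ E(F) → ∀ v : V(G), G.Inc e v → cross v = e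

lemma IsFactor.exists_frame {G F : Graph α β} [G.Loopless] (hV : V(G).Finite)
    (hcubic : G.IsRegular 3) (hF : F.IsFactor G 2) : Nonempty (Frame G F) := by
  have : F.Loopless := Loopless.anti hF.1.le
  obtain ⟨next, out, h1, h2, h3⟩ := hF.2.exists_next hF.1.vertexSet_eq hV
  have hle := hF.1.le
  have hcr (v : V(G)) : ∃ e, G.Inc e v ∧ e ∉ E(F) ∧ ∀ e', G.Inc e' v → e' ∉ E(F) → e = e' := by
    have hsub : F.incidenceSet v ⊆ G.incidenceSet v := fun e he => Inc.mono hle he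
    have hv : (v : α) ∈ V(F) := by rw [hF.1.vertexSet_eq]; exact v.2
    have h4 := Set.encard_sdiff_add_encard_of_subset hsub
    rw [hF.2 v hv, hcubic v v.2] at h4
    have h5 : (G.incidenceSet v \ F.incidenceSet v).encard = 1 := by
      have h6 : (G.incidenceSet v \ F.incidenceSet v).encard + 2 = 1 + 2 := by
        rw [show (1 : ℕ∞) + 2 = 3 by norm_num]; exact_mod_cast h4
      exact (ENat.add_left_injective_of_ne_top (by decide)) h6
    obtain ⟨e, he⟩ := Set.encard_eq_one.1 h5
    have hmem (e' : β) (h7 : G.Inc e' v) : e' ∉ E(F) ↔ e' = e := by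
      rw [← Set.mem_singleton_iff, ← he]
      refine ⟨fun h => ⟨h7, fun h8 => h (Inc.edge_mem h8)⟩, fun h h8 => h.2 ?_⟩
      exact (hle.inc_congr h8).2 h7
    have he' : G.Inc e v := by
      have : e ∈ ({e} : Set β) := rfl
      rw [← he] at this
      exact this.1
    exact ⟨e, he', (hmem e he').2 rfl, fun e' h9 h10 => ((hmem e' h9).1 h10).symm⟩
  choose cross hci hcn hcu using hcr
  have hm (v : V(G)) : ∃ y : V(G), G.IsLink (cross v) v y := by
    obtain ⟨y, hy⟩ := hci v
    exact ⟨⟨y, hy.right_mem⟩, hy⟩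
  choose mate hmate using hm
  exact ⟨⟨next, out, mate, cross, hle, h1, h2, h3, hmate, hcn,
    fun e he v hv => hcu v e hv he⟩⟩

namespace Frame

variable {G F : Graph α β} (K : Frame G F)

lemma link (v : V(G)) : G.IsLink (K.out v) v (K.next v) := (K.out_link v).mono K.le

lemma out_mem (v : V(G)) : K.out v ∈ E(F) := (K.out_link v).edge_mem

lemma next_ne [G.Loopless] (v : V(G)) : K.next v ≠ v := fun h =>
  (K.link v).ne (congrArg Subtype.val h.symm)

lemma cross_mate (v : V(G)) : K.cross (K.mate v) = K.cross v :=
  K.cross_eq _ (K.cross_notMem v) _ (K.cross_link v).inc_right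

lemma mate_involutive : Involutive K.mate := by
  intro v
  have h := K.cross_link (K.mate v)
  rw [K.cross_mate] at h
  exact Subtype.ext (h.right_unique (K.cross_link v).symm)

lemma mate_ne [G.Loopless] (v : V(G)) : K.mate v ≠ v := fun h =>
  (K.cross_link v).ne (congrArg Subtype.val h.symm)

lemma eq_out_or_eq_cross {e : β} (he : e ∈ E(G)) : (∃ v, e = K.out v) ∨ ∃ v, e = K.cross v := by
  by_cases h : e ∈ E(F)
  · obtain ⟨v, rfl⟩ := K.out_surjective e h
    exact Or.inl ⟨v, rfl⟩
  · obtain ⟨x, y, hxy⟩ := exists_isLink_of_mem_edgeSet he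
    exact Or.inr ⟨⟨x, hxy.left_mem⟩, (K.cross_eq e h _ hxy.inc_left).symm⟩

/-- A symmetric relation holds along every edge once it holds along the edges of the frame. -/
lemma forall_link {P : β → α → α → Prop} (hsymm : ∀ e x y, P e x y → P e y x)
    (hout : ∀ v, P (K.out v) v (K.next v)) (hcross : ∀ v, P (K.cross v) v (K.mate v))
    {e : β} {x y : α} (h : G.IsLink e x y) : P e x y := by
  obtain ⟨v, rfl⟩ | ⟨v, rfl⟩ := K.eq_out_or_eq_cross h.edge_mem
  · obtain ⟨rfl, rfl⟩ | ⟨rfl, rfl⟩ := h.eq_and_eq_or_eq_and_eq (K.link v)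
    · exact hout v
    · exact hsymm _ _ _ (hout v)
  · obtain ⟨rfl, rfl⟩ | ⟨rfl, rfl⟩ := h.eq_and_eq_or_eq_and_eq (K.cross_link v)
    · exact hcross v
    · exact hsymm _ _ _ (hcross v)

lemma out_ne_cross (u v : V(G)) : K.out u ≠ K.cross v := fun h =>
  K.cross_notMem v (h ▸ K.out_mem u)

lemma incidenceSet_eq (v : V(G)) :
    G.incidenceSet v = {K.out v, K.out (K.next.symm v), K.cross v} := by
  ext e
  simp only [mem_incidenceSet, Set.mem_insert_iff, Set.mem_singleton_iff]
  constructor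
  · intro h
    by_cases he : e ∈ E(F)
    · obtain ⟨u, rfl⟩ := K.out_surjective e he
      obtain h1 | h1 := h.eq_or_eq_of_isLink (K.link u)
      · exact Or.inl (congrArg K.out (Subtype.ext h1.symm))
      · right; left
        rw [Subtype.ext h1, Equiv.symm_apply_apply]
    · exact Or.inr (Or.inr (K.cross_eq e he v h).symm)
  · rintro (rfl | rfl | rfl)
    · exact (K.link v).inc_left
    · have := (K.link (K.next.symm v)).inc_right
      rwa [Equiv.apply_symm_apply] at this
    · exact (K.cross_link v).inc_left

end Frame

end Graph

end

/-! ### Flow number below 4 and antibalanced signatures -/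

noncomputable section

open Equiv Function

namespace Graph

variable {α β : Type*}

/-- `σ` is antibalanced: switching at some set of vertices makes all edges negative. -/
def IsAntibalanced (G : Graph α β) (σ : β → ℤˣ) : Prop :=
  ∃ s : α → ℤˣ, ∀ e x y, G.IsLink e x y → σ e = -(s x * s y)

lemma boundary_eq {G : Graph α β} {v : α} {a b c : β} (h : G.incidenceSet v = {a, b, c})
    (hab : a ≠ b) (hac : a ≠ c) (hbc : b ≠ c) (τ : β → α → ℤˣ) (f : β → ℝ) :
    G.boundary τ f v =
      ((τ a v : ℤ) : ℝ) * f a + (((τ b v : ℤ) : ℝ) * f b + ((τ c v : ℤ) : ℝ) * f c) := by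
  rw [boundary, h, finsum_mem_insert _ (by simp [hab, hac]) (Set.toFinite _),
    finsum_mem_pair hbc]

lemma units_cast_cases (u : ℤˣ) : ((u : ℤ) : ℝ) = 1 ∧ u = 1 ∨ ((u : ℤ) : ℝ) = -1 ∧ u = -1 := by
  rcases Int.units_eq_one_or u with rfl | rfl <;> simp

lemma abs_units_mul (u : ℤˣ) (x : ℝ) : |((u : ℤ) : ℝ) * x| = |x| := by
  rcases units_cast_cases u with ⟨h, -⟩ | ⟨h, -⟩ <;> simp [h]

/-- The values of a nowhere-zero flow at a vertex of a cubic graph. -/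
lemma IsRegular.exists_flow_triple {G : Graph α β} (hcubic : G.IsRegular 3) {τ : β → α → ℤˣ}
    {r : ℝ} {f : β → ℝ} (hf : G.IsFlow τ r f) (hnz : ∀ e ∈ E(G), f e ≠ 0) {v : α} (hv : v ∈ V(G)) :
    ∃ a b c, G.incidenceSet v = {a, b, c} ∧
      (∀ e ∈ G.incidenceSet v, |((τ e v : ℤ) : ℝ) * f e| ∈ Set.Icc 1 (r - 1)) ∧
      ((τ a v : ℤ) : ℝ) * f a + (((τ b v : ℤ) : ℝ) * f b + ((τ c v : ℤ) : ℝ) * f c) = 0 := by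
  obtain ⟨a, b, c, hab, hac, hbc, h⟩ := Set.encard_eq_three.1 (hcubic v hv)
  refine ⟨a, b, c, h, fun e he => ?_, ?_⟩
  · have he' := incidenceSet_subset_edgeSet v he
    rw [abs_units_mul]
    obtain h1 | h1 := hf.1 e he'
    · exact h1
    · exact absurd (abs_eq_zero.1 h1) (hnz e he')
  · rw [← boundary_eq h hab hac hbc, hf.2 v hv]

/-- Two of the numbers share a sign; the third is opposite and has absolute value at least 2. Since
that value is below 3, the first two are below 2 in absolute value. Hence the sign of the large
number is read off from `a` alone. -/
lemma sign_pattern {r a b c : ℝ} (hr : r < 4) (h : a + (b + c) = 0)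
    (ha : |a| ∈ Set.Icc 1 (r - 1)) (hb : |b| ∈ Set.Icc 1 (r - 1)) (hc : |c| ∈ Set.Icc 1 (r - 1)) :
    (2 ≤ a ∨ 2 ≤ b ∨ 2 ≤ c) ↔ (2 ≤ |a| ↔ 0 < a) := by
  obtain ⟨ha1, ha2⟩ := ha
  obtain ⟨hb1, hb2⟩ := hb
  obtain ⟨hc1, hc2⟩ := hc
  rcases abs_cases a with ⟨h1, h1'⟩ | ⟨h1, h1'⟩ <;> rcases abs_cases b with ⟨h2, h2'⟩ | ⟨h2, h2'⟩ <;>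
    rcases abs_cases c with ⟨h3, h3'⟩ | ⟨h3, h3'⟩ <;>
    rw [h1] at ha1 ha2 ⊢ <;> rw [h2] at hb1 hb2 <;> rw [h3] at hc1 hc2 <;>
    constructor <;> intro h4
  all_goals first
    | (exfalso; linarith)
    | (constructor <;> intro h5 <;> rcases h4 with h4 | h4 | h4 <;> linarith)
    | (by_contra h6
       push Not at h6
       obtain ⟨h6, h7, h8⟩ := h6
       first
       | linarith
       | (have := h4.1 (by linarith); linarith)
       | (have := h4.2 (by linarith); linarith))

/-- A signed cubic graph with a nowhere-zero `r`-flow for some `r < 4` is antibalanced. -/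
lemma IsNowhereZeroFlow.isAntibalanced {G : Graph α β} (hcubic : G.IsRegular 3) {σ : β → ℤˣ}
    {r : ℝ} {f : β → ℝ} (hr : r < 4) (h : G.IsNowhereZeroFlow σ r f) : G.IsAntibalanced σ := by
  classical
  obtain ⟨⟨τ, hτ, hf⟩, hnz⟩ := h
  let s : α → ℤˣ := fun v =>
    if ∃ e ∈ G.incidenceSet v, 2 ≤ ((τ e v : ℤ) : ℝ) * f e then 1 else -1
  -- A sign depending on the edge only: at both ends it converts the direction of `e` into the sign
  -- of the large edge there, so it cancels in `s x * s y`.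
  let κ : β → ℤˣ := fun e => if (2 ≤ |f e| ↔ 0 < f e) then 1 else -1
  have key (e : β) (v : α) (hev : G.Inc e v) : s v = τ e v * κ e := by
    obtain ⟨a, b, c, hinc, hI, hsum⟩ := hcubic.exists_flow_triple hf hnz hev.vertex_mem
    have ha := hI a (by simp [hinc])
    have hb := hI b (by simp [hinc])
    have hc := hI c (by simp [hinc])
    have h1 : (∃ e ∈ G.incidenceSet v, 2 ≤ ((τ e v : ℤ) : ℝ) * f e) ↔
        (2 ≤ |((τ e v : ℤ) : ℝ) * f e| ↔ 0 < ((τ e v : ℤ) : ℝ) * f e) := by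
      have hmem : e ∈ G.incidenceSet v := hev
      rw [hinc] at hmem ⊢
      simp only [Set.mem_insert_iff, Set.mem_singleton_iff, exists_eq_or_imp, exists_eq_left]
      rcases hmem with rfl | rfl | rfl
      · exact sign_pattern hr hsum ha hb hc
      · rw [← sign_pattern hr (by linarith) hb ha hc]
        tauto
      · rw [← sign_pattern hr (by linarith) hc ha hb]
        tauto
    have hne : f e ≠ 0 := hnz e hev.edge_mem
    simp only [s, κ, h1, abs_units_mul]
    rcases units_cast_cases (τ e v) with ⟨h2, h3⟩ | ⟨h2, h3⟩
    · simp [h3]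
    · have h4 : (0 < ((τ e v : ℤ) : ℝ) * f e) ↔ ¬ (0 < f e) := by
        rw [h2, not_lt, neg_one_mul, neg_pos]
        exact ⟨le_of_lt, fun h => lt_of_le_of_ne h hne⟩
      simp only [h4]
      rw [h3]
      by_cases h5 : 2 ≤ |f e| <;> by_cases h6 : 0 < f e <;> simp [h5, h6]
  refine ⟨s, fun e x y hxy => ?_⟩
  have h1 := hτ e x y hxy
  rw [key e x hxy.inc_left, key e y hxy.inc_right, mul_mul_mul_comm, h1, Int.units_mul_self]
  simp

lemma IsNowhereZeroFlow.three_le {G : Graph α β} (hcubic : G.IsRegular 3) {σ : β → ℤˣ}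
    {r : ℝ} {f : β → ℝ} (h : G.IsNowhereZeroFlow σ r f) (hne : V(G).Nonempty) : 3 ≤ r := by
  obtain ⟨⟨τ, hτ, hf⟩, hnz⟩ := h
  obtain ⟨v, hv⟩ := hne
  obtain ⟨a, b, c, hinc, hI, hsum⟩ := hcubic.exists_flow_triple hf hnz hv
  have ha := hI a (by simp [hinc])
  have hb := hI b (by simp [hinc])
  have hc := hI c (by simp [hinc])
  obtain ⟨ha1, ha2⟩ := ha
  obtain ⟨hb1, hb2⟩ := hb
  obtain ⟨hc1, hc2⟩ := hc
  generalize ((τ a v : ℤ) : ℝ) * f a = a at *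
  generalize ((τ b v : ℤ) : ℝ) * f b = b at *
  generalize ((τ c v : ℤ) : ℝ) * f c = c at *
  rcases abs_cases a with ⟨h1, h1'⟩ | ⟨h1, h1'⟩ <;> rcases abs_cases b with ⟨h2, h2'⟩ | ⟨h2, h2'⟩ <;>
    rcases abs_cases c with ⟨h3, h3'⟩ | ⟨h3, h3'⟩ <;> linarith

lemma le_circularFlowNumber {G : Graph α β} {σ : β → ℤˣ} {q : ℝ}
    (h : ∀ r f, G.IsNowhereZeroFlow σ r f → q ≤ r) : (q : EReal) ≤ G.circularFlowNumber σ := by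
  refine le_sInf ?_
  rintro _ ⟨r, ⟨-, f, hf⟩, rfl⟩
  exact EReal.coe_le_coe_iff.2 (h r f hf)

lemma circularFlowNumber_le {G : Graph α β} {σ : β → ℤˣ} {r : ℝ} {f : β → ℝ} (hr : 2 ≤ r)
    (hf : G.IsNowhereZeroFlow σ r f) : G.circularFlowNumber σ ≤ r :=
  sInf_le ⟨r, ⟨hr, f, hf⟩, rfl⟩

lemma circularFlowNumber_le_integerFlowNumber (G : Graph α β) (σ : β → ℤˣ) :
    G.circularFlowNumber σ ≤ G.integerFlowNumber σ := by
  refine sInf_le_sInf (Set.image_mono ?_)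
  rintro r ⟨hr, f, hf, -⟩
  exact ⟨hr, f, hf⟩

lemma isAntibalanced_of_circularFlowNumber_lt {G : Graph α β} (hcubic : G.IsRegular 3)
    {σ : β → ℤˣ} (h : G.circularFlowNumber σ < (4 : ℝ)) : G.IsAntibalanced σ := by
  obtain ⟨_, ⟨r, ⟨-, f, hf⟩, rfl⟩, hr⟩ := sInf_lt_iff.1 h
  exact hf.isAntibalanced hcubic (EReal.coe_lt_coe_iff.1 hr)

/-- The circular flow number of an antibalanced cubic graph with a 1-factor. -/
lemma IsAntibalanced.circularFlowNumber_eq {G F : Graph α β} [G.Loopless] (K : Frame G F)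
    (hcubic : G.IsRegular 3) (hne : V(G).Nonempty) {σ : β → ℤˣ} (h : G.IsAntibalanced σ) :
    G.circularFlowNumber σ = (3 : ℝ) := by
  classical
  refine le_antisymm ?_ (le_circularFlowNumber fun r f hf => hf.three_le hcubic hne)
  obtain ⟨s, hs⟩ := h
  -- With signs `s v` on the 2-factor and `-s v` on the matching, the boundary at `v` is `s v * (1 +
  -- 1 - 2)`.
  refine circularFlowNumber_le (f := fun e => if e ∈ E(F) then 1 else 2) (by norm_num)
    ⟨⟨fun e v => if e ∈ E(F) then s v else - s v, fun e x y hxy => ?_, fun e he => ?_,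
      fun v hv => ?_⟩, fun e he => ?_⟩
  · have := hs e x y hxy
    dsimp only
    split_ifs <;> rw [this] <;> simp
  · left
    dsimp only
    split_ifs <;> norm_num
  · have hv' : K.next.symm ⟨v, hv⟩ ≠ ⟨v, hv⟩ := fun h => by
      have := K.next_ne (K.next.symm ⟨v, hv⟩)
      rw [Equiv.apply_symm_apply] at this
      exact this h.symm
    rw [boundary_eq (K.incidenceSet_eq ⟨v, hv⟩) (fun h => hv' (K.out_injective h).symm)
      (K.out_ne_cross _ _) (K.out_ne_cross _ _)]
    simp only [K.out_mem, K.cross_notMem, if_true, if_false]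
    push_cast
    ring
  · dsimp only
    split_ifs <;> norm_num

end Graph

end

/-! ### One negative edge per odd circuit: 4-flows and failure of antibalance -/

noncomputable section

open Equiv Function

namespace Graph

variable {α β : Type*}

open Classical in
/-- The signature whose negative edges are those in `N`. -/
def signature (N : Set β) (e : β) : ℤˣ := if e ∈ N then -1 else 1

lemma negEdges_signature {G : Graph α β} {N : Set β} (hN : N ⊆ E(G)) :
    G.negEdges (signature N) = N := by
  ext e
  by_cases h : e ∈ N
  · simp [negEdges, signature, h, hN h]
  · simp [negEdges, signature, h]

namespace Frame

variable {G F : Graph α β} (K : Frame G F)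

/-- The edges of odd cycles that lead into a base point. -/
def negSet (b : V(G) → V(G)) : Set β :=
  {e | ∃ u, b (K.next u) = K.next u ∧ Odd (minimalPeriod K.next u) ∧ K.out u = e}

lemma out_mem_negSet {b : V(G) → V(G)} {u : V(G)} :
    K.out u ∈ K.negSet b ↔ b (K.next u) = K.next u ∧ Odd (minimalPeriod K.next u) := by
  constructor
  · rintro ⟨w, h1, h2, h3⟩
    rw [← K.out_injective h3]
    exact ⟨h1, h2⟩
  · rintro ⟨h1, h2⟩
    exact ⟨u, h1, h2, rfl⟩

lemma negSet_subset (b : V(G) → V(G)) : K.negSet b ⊆ E(F) := by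
  rintro _ ⟨w, -, -, rfl⟩
  exact K.out_mem _

lemma negSet_subset_edgeSet (b : V(G) → V(G)) : K.negSet b ⊆ E(G) :=
  (K.negSet_subset b).trans K.le.edgeSet_mono

lemma cross_notMem_negSet (b : V(G) → V(G)) (v : V(G)) : K.cross v ∉ K.negSet b := fun h =>
  K.cross_notMem v (K.negSet_subset b h)

/-- Signs that alternate along the matching edges and along every second edge of a cycle. -/
lemma exists_alternating_signs [G.Loopless] [Finite V(G)] {b : V(G) → V(G)}
    (hb : K.next.IsBase b) :
    ∃ (p : V(G) → Bool) (m : V(G) → ℤˣ), (∀ v, b v = v → p v = false) ∧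
      (∀ v, b (K.next v) ≠ K.next v → p (K.next v) = !p v) ∧
      (∀ v, b (K.next v) = K.next v → (p v = true ↔ Even (minimalPeriod K.next v))) ∧
      (∀ v, p v = true → m (K.next v) = -m v) ∧ ∀ v, m (K.mate v) = -m v := by
  classical
  obtain ⟨p, hp1, hp2, hp3⟩ := hb.exists_alternating
  have hp4 (v : V(G)) (hv : p v = true) : p (K.next v) = false := by
    by_cases h : b (K.next v) = K.next v
    · exact hp1 _ h
    · rw [hp2 v h, hv]; rfl
  -- Pairs the ends of the circuit edges leaving vertices with `p` true. Only the base points of odd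
  -- circuits stay unpaired.
  have hinv : Involutive fun v => if p v then K.next v else
      if p (K.next.symm v) then K.next.symm v else v := by
    intro v
    by_cases h1 : p v = true
    · simp [h1, hp4 v h1]
    · by_cases h2 : p (K.next.symm v) = true
      · simp [h1, h2]
      · simp [h1, h2]
  obtain ⟨c, hc⟩ := exists_coloring_of_partial_involutive hinv K.mate_involutive K.mate_ne
  have hneg {i j : Bool} (h : i ≠ j) : (if i then (1 : ℤˣ) else -1) = -(if j then 1 else -1) := by
    cases i <;> cases j <;> simp_all
  refine ⟨p, fun v => if c v then 1 else -1, hp1, hp2, hp3, fun v hv => hneg ?_,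
    fun v => hneg (hc v).2⟩
  have := (hc v).1
  simp only [hv, if_true] at this
  exact this (K.next_ne v)

/-- Making one edge of each odd circuit of a 2-factor negative gives an integer 4-flow. -/
lemma exists_isNowhereZeroFlow [G.Loopless] [Finite V(G)] {b : V(G) → V(G)}
    (hb : K.next.IsBase b) :
    ∃ f, G.IsNowhereZeroFlow (signature (K.negSet b)) 4 f ∧ ∀ e ∈ E(G), ∃ n : ℤ, f e = n := by
  classical
  set σ := signature (K.negSet b) with hσ
  obtain ⟨p, m, hp1, hp2, hp3, hm1, hm2⟩ := K.exists_alternating_signs hb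
  have htail (v : V(G)) (h : ∃ u, K.out u = K.out v) : h.choose = v :=
    K.out_injective h.choose_spec
  have hncross (v : V(G)) : ¬ ∃ u, K.out u = K.cross v := fun ⟨u, hu⟩ => K.out_ne_cross u v hu
  obtain ⟨τ, hτ1, hτ2⟩ : ∃ τ : β → α → ℤˣ,
      (∀ (v : V(G)) (x : α), τ (K.out v) x = if x = v then 1 else -σ (K.out v)) ∧
      ∀ v u : V(G), τ (K.cross v) u = - m u := by
    refine ⟨fun e x => if h : ∃ v, K.out v = e then (if x = h.choose then 1 else -σ e) else
      if hx : x ∈ V(G) then - m ⟨x, hx⟩ else 1, fun v x => ?_, fun v u => ?_⟩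
    · have h : ∃ u, K.out u = K.out v := ⟨v, rfl⟩
      beta_reduce
      rw [dif_pos h, htail v h]
    · beta_reduce
      rw [dif_neg (hncross v), dif_pos u.2]
  -- Passing a vertex `v` must add `2 * m v`. Since `m` flips along edges with `p` true, these
  -- increments cancel in pairs. The starting value `m (b v)` is forced at an odd base point, where
  -- the value returns negated.
  let g : V(G) → ℤ := fun v => m (b v) + if p v then 2 * (m v : ℤ) else 0
  obtain ⟨f, hf1, hf2⟩ : ∃ f : β → ℤ, (∀ v, f (K.out v) = g v) ∧ ∀ v, f (K.cross v) = 2 := by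
    refine ⟨fun e => if h : ∃ v, K.out v = e then g h.choose else 2, fun v => ?_, fun v => ?_⟩
    · have h : ∃ u, K.out u = K.out v := ⟨v, rfl⟩
      beta_reduce
      rw [dif_pos h, htail v h]
    · beta_reduce
      rw [dif_neg (hncross v)]
  have hg (v : V(G)) : 1 ≤ |g v| ∧ |g v| ≤ 3 := by
    simp only [g]
    rcases Int.units_eq_one_or (m (b v)) with h1 | h1 <;>
      rcases Int.units_eq_one_or (m v) with h2 | h2 <;> rw [h1, h2] <;> split_ifs <;> decide
  have hfb (e : β) (he : e ∈ E(G)) : 1 ≤ |f e| ∧ |f e| ≤ 3 := by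
    obtain ⟨v, rfl⟩ | ⟨v, rfl⟩ := K.eq_out_or_eq_cross he
    · rw [hf1]; exact hg v
    · rw [hf2]; decide
  have hkey (u : V(G)) : g (K.next u) - (σ (K.out u) : ℤ) * g u - 2 * m (K.next u) = 0 := by
    have hbu := hb.base_apply u
    by_cases h1 : b (K.next u) = K.next u
    · have h2 : p (K.next u) = false := hp1 _ h1
      simp only [g, h2, ← hbu, h1]
      by_cases h3 : p u = true
      · have h4 : K.out u ∉ K.negSet b := by
          rw [out_mem_negSet, ← Nat.not_even_iff_odd]
          exact fun h => h.2 ((hp3 u h1).1 h3)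
        simp [h3, hσ, signature, h4, hm1 u h3]
      · have h4 : K.out u ∈ K.negSet b := by
          rw [out_mem_negSet, ← Nat.not_even_iff_odd]
          exact ⟨h1, fun h => h3 ((hp3 u h1).2 h)⟩
        simp [h3, hσ, signature, h4]
        ring
    · have h2 := hp2 u h1
      have h4 : K.out u ∉ K.negSet b := by
        rw [out_mem_negSet]
        exact fun h => h1 h.1
      by_cases h3 : p u = true
      · simp [g, h2, h3, hbu, hσ, signature, h4, hm1 u h3]
      · simp [g, h2, h3, hbu, hσ, signature, h4]
  refine ⟨fun e => f e, ⟨⟨τ, fun e x y hxy => ?_, fun e he => ?_, fun v hv => ?_⟩,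
    fun e he => ?_⟩, fun e he => ⟨f e, rfl⟩⟩
  · refine K.forall_link (P := fun e x y => τ e x * τ e y = -σ e)
      (fun e x y h => by rwa [mul_comm]) (fun v => ?_) (fun v => ?_) hxy
    · rw [hτ1, hτ1, if_pos rfl, if_neg (K.link v).ne.symm, one_mul]
    · rw [hτ2, hτ2, hm2, hσ, signature, if_neg (K.cross_notMem_negSet b v)]
      simp
  · left
    have := hfb e he
    beta_reduce
    constructor
    · exact_mod_cast this.1
    · norm_num
      exact_mod_cast this.2
  · obtain ⟨u, hu⟩ := K.next.surjective ⟨v, hv⟩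
    obtain rfl : (K.next u : α) = v := congrArg Subtype.val hu
    rw [boundary_eq (K.incidenceSet_eq (K.next u)) (fun h => ?_)
      (K.out_ne_cross _ _) (K.out_ne_cross _ _), Equiv.symm_apply_apply, hτ1, hτ1, hτ2, hf1, hf1,
      hf2, if_pos rfl, if_neg (K.link u).ne.symm]
    · have := hkey u
      have h2 : ((1 : ℤˣ) : ℤ) * g (K.next u) + (((-σ (K.out u) : ℤˣ) : ℤ) * g u +
          ((- m (K.next u) : ℤˣ) : ℤ) * 2) = 0 := by
        push_cast
        linarith
      exact_mod_cast h2
    · have := K.out_injective h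
      rw [Equiv.symm_apply_apply] at this
      exact K.next_ne u this
  · have := (hfb e he).1
    simp only [ne_eq, Int.cast_eq_zero]
    rintro h
    rw [h] at this
    exact absurd this (by decide)

/-- Some choice of one negative edge in each odd circuit is not antibalanced. -/
lemma exists_not_isAntibalanced [G.Loopless] [Finite V(G)] (hbip : ¬ G.IsBipartite) :
    ∃ b, K.next.IsBase b ∧ ¬ G.IsAntibalanced (signature (K.negSet b)) := by
  classical
  by_contra! hall
  have hodd := K.next.not_odd_of_pendant K.next_ne K.mate_involutive K.mate_ne (fun v hv => by
    obtain ⟨b₁, hb₁, hP₁, hQ₁⟩ := K.next.exists_isBase (· = v)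
    obtain ⟨b₂, hb₂, hP₂, hQ₂⟩ := K.next.exists_isBase (· = K.next v)
    obtain ⟨s₁, hs₁⟩ := hall b₁ hb₁
    obtain ⟨s₂, hs₂⟩ := hall b₂ hb₂
    -- The two signatures differ only on the two circuit edges at `v`, so `t` changes sign exactly
    -- across these. The vertices other than `v` with `t` equal to `t v` form the pendant set.
    let t : V(G) → ℤˣ := fun x => s₁ x * s₂ x
    have ht (e : β) (x y : V(G)) (h : G.IsLink e x y) :
        t y = t x * (signature (K.negSet b₁) e * signature (K.negSet b₂) e) := by
      rw [hs₁ e x y h, hs₂ e x y h]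
      simp only [t, neg_mul_neg]
      rcases Int.units_eq_one_or (s₁ x) with h1 | h1 <;>
        rcases Int.units_eq_one_or (s₂ x) with h2 | h2 <;> rw [h1, h2] <;> simp
    have hc₁ (u : V(G)) (hu : K.next.SameCycle v u) : K.out u ∈ K.negSet b₁ ↔ K.next u = v := by
      have hu' : K.next.SameCycle v (K.next u) := Perm.sameCycle_apply_right.2 hu
      rw [out_mem_negSet, hP₁ (K.next u) ⟨v, hu'.symm, rfl⟩, ← hu.minimalPeriod_eq]
      exact ⟨fun h => h.1.symm, fun h => ⟨h.symm, hv⟩⟩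
    have hc₂ (u : V(G)) (hu : K.next.SameCycle v u) : K.out u ∈ K.negSet b₂ ↔ u = v := by
      have hu' : K.next.SameCycle (K.next v) (K.next u) :=
        Perm.sameCycle_apply_right.2 (Perm.sameCycle_apply_left.2 hu)
      rw [out_mem_negSet, hP₂ (K.next u) ⟨_, hu'.symm, rfl⟩, ← hu.minimalPeriod_eq]
      exact ⟨fun h => (K.next.injective h.1).symm, fun h => ⟨by rw [h], hv⟩⟩
    have hc₃ (u : V(G)) (hu : ¬ K.next.SameCycle v u) :
        K.out u ∈ K.negSet b₁ ↔ K.out u ∈ K.negSet b₂ := by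
      have h1 : b₁ (K.next u) = b₂ (K.next u) := by
        rw [hQ₁, hQ₂]
        · rintro ⟨_, h, rfl⟩
          exact hu (Perm.sameCycle_apply_right.1 (Perm.sameCycle_apply_left.1 h)).symm
        · rintro ⟨_, h, rfl⟩
          exact hu (Perm.sameCycle_apply_left.1 h).symm
      rw [out_mem_negSet, out_mem_negSet, h1]
    have ht₀ (u : V(G)) (hu : ¬ K.next.SameCycle v u) : t (K.next u) = t u := by
      rw [ht _ _ _ (K.link u)]
      by_cases h : K.out u ∈ K.negSet b₂ <;> simp [signature, hc₃ u hu, h]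
    have ht₁ : t (K.next v) = - t v := by
      have h1 := hc₁ v (Perm.SameCycle.refl _ _)
      have h2 := hc₂ v (Perm.SameCycle.refl _ _)
      rw [ht _ _ _ (K.link v)]
      simp [signature, h1, h2, K.next_ne]
    have ht₂ (x : V(G)) (hx : K.next.SameCycle v x) (hxv : x ≠ v) : t x = - t v := by
      rw [← ht₁]
      refine Perm.eq_of_constant_off (fun u hu h1 h2 => ?_) hx hxv
      rw [ht _ _ _ (K.link u)]
      simp [signature, hc₁ u hu, hc₂ u hu, h1, h2]
    have ht₃ (x : V(G)) : t (K.mate x) = t x := by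
      rw [ht _ _ _ (K.cross_link x)]
      simp [signature, K.cross_notMem_negSet]
    have hA (x : V(G)) (hx : K.next.SameCycle v x) : ¬ (t x = t v ∧ x ≠ v) := by
      rintro ⟨h1, h2⟩
      rw [ht₂ x hx h2] at h1
      rcases Int.units_eq_one_or (t v) with h | h <;> rw [h] at h1 <;> exact absurd h1 (by decide)
    refine ⟨{x | t x = t v ∧ x ≠ v}, fun x => ?_, hA, ⟨ht₃ v, K.mate_ne v⟩,
      fun x hx hxv => ⟨(ht₃ x).trans hx.1, ?_⟩⟩
    · by_cases hx : K.next.SameCycle v x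
      · exact iff_of_false (hA x hx) (hA _ (Perm.sameCycle_apply_right.2 hx))
      · have h1 : x ≠ v := by
          rintro rfl
          exact hx (Perm.SameCycle.refl _ _)
        have h2 : K.next x ≠ v := by
          rintro rfl
          exact hx (Perm.sameCycle_apply_left.2 (Perm.SameCycle.refl _ _))
        simp [ht₀ x hx, h1, h2]
    · rintro rfl
      exact hxv (K.mate_involutive x).symm)
  obtain ⟨b, hb, -⟩ := K.next.exists_isBase fun _ => False
  obtain ⟨s, hs⟩ := hall b hb
  -- Without odd circuits no edge is negative, and antibalance of the all-positive signature is a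
  -- 2-colouring.
  refine hbip ⟨fun x => decide (s x = 1), fun e x y hxy h => ?_⟩
  have h1 := hs e x y hxy
  have h2 : e ∉ K.negSet b := by
    rintro ⟨u, -, hu, -⟩
    exact hodd u hu
  rw [decide_eq_decide] at h
  rw [signature, if_neg h2] at h1
  rcases Int.units_eq_one_or (s x) with h3 | h3 <;> rcases Int.units_eq_one_or (s y) with h4 | h4 <;>
    rw [h3, h4] at h h1 <;> revert h h1 <;> decide

end Frame

end Graph

end

/-! ### Odd circuits of a 2-factor and their negative edges -/

noncomputable section

open Equiv Function

lemma Equiv.Perm.ncard_sameCycle {V : Type*} [Finite V] (ρ : Perm V) (v : V) :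
    {x | ρ.SameCycle v x}.ncard = minimalPeriod ρ v := by
  have h : {x | ρ.SameCycle v x} = (fun k => ρ^[k] v) '' Set.Iio (minimalPeriod ρ v) := by
    ext x
    constructor
    · intro hx
      obtain ⟨k, hk, rfl⟩ := SameCycle.exists_iterate_lt hx
      exact ⟨k, hk, rfl⟩
    · rintro ⟨k, -, rfl⟩
      exact sameCycle_iterate ρ k v
  have hinj : Set.InjOn (fun k => ρ^[k] v) (Set.Iio (minimalPeriod ρ v)) := fun i hi j hj hij =>
    (iterate_eq_iterate_iff_of_lt_minimalPeriod hi hj).1 hij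
  rw [h, hinj.ncard_image, ← Nat.card_coe_set_eq, Nat.card_eq_fintype_card,
    Fintype.card_Iio, Nat.card_Iio]

namespace Graph

variable {α β : Type*}

namespace Frame

variable {G F : Graph α β} (K : Frame G F)

/-- The vertices on the circuit of the 2-factor through `v`. -/
def orbit (v : V(G)) : Set α := Subtype.val '' {x | K.next.SameCycle v x}

lemma coe_mem_orbit {v x : V(G)} : (x : α) ∈ K.orbit v ↔ K.next.SameCycle v x := by
  simp [orbit]

/-- The circuit of the 2-factor through `v`. -/
def circuit (v : V(G)) : Graph α β := F.induce (K.orbit v)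

lemma mem_orbit_of_isLink {v : V(G)} {e : β} {x y : α} (h : F.IsLink e x y)
    (hx : x ∈ K.orbit v) : y ∈ K.orbit v := by
  obtain ⟨u, rfl⟩ := K.out_surjective e h.edge_mem
  obtain ⟨rfl, rfl⟩ | ⟨rfl, rfl⟩ := h.eq_and_eq_or_eq_and_eq (K.out_link u)
  · rw [coe_mem_orbit] at hx ⊢
    exact Perm.sameCycle_apply_right.2 hx
  · rw [coe_mem_orbit] at hx ⊢
    exact Perm.sameCycle_apply_right.1 hx

lemma circuit_inc {v : V(G)} {e : β} {x : α} :
    (K.circuit v).Inc e x ↔ F.Inc e x ∧ x ∈ K.orbit v := by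
  constructor
  · rintro ⟨y, h⟩
    exact ⟨⟨y, h.1⟩, h.2.1⟩
  · rintro ⟨⟨y, h⟩, hx⟩
    exact ⟨y, h, hx, K.mem_orbit_of_isLink h hx⟩

lemma orbit_subset (v : V(G)) : K.orbit v ⊆ V(F) := by
  rintro _ ⟨x, -, rfl⟩
  exact (K.out_link x).left_mem

lemma circuit_le (v : V(G)) : K.circuit v ≤ F := induce_le (K.orbit_subset v)

lemma isCircuit_circuit [Finite V(G)] (hF : F.IsRegular 2) (v : V(G)) :
    (K.circuit v).IsCircuit := by
  refine ⟨⟨⟨v, ?_⟩, ?_⟩, fun x hx => ?_⟩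
  · exact K.coe_mem_orbit.2 (Perm.SameCycle.refl _ _)
  · rintro _ ⟨x, hx, rfl⟩ _ ⟨y, hy, rfl⟩
    obtain ⟨k, -, rfl⟩ := (hx.symm.trans hy : K.next.SameCycle x y).exists_iterate_lt
    clear hy
    induction k with
    | zero => exact Relation.ReflTransGen.refl
    | succ k ih =>
      refine Relation.ReflTransGen.tail ih ⟨K.out (K.next^[k] x), ?_⟩
      rw [iterate_succ_apply']
      have h1 : K.next.SameCycle v (K.next^[k] x) := hx.trans (Perm.sameCycle_iterate _ _ _)
      exact ⟨K.out_link _, K.coe_mem_orbit.2 h1,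
        K.coe_mem_orbit.2 (Perm.sameCycle_apply_right.2 h1)⟩
  · have hx' : x ∈ K.orbit v := hx
    have : (K.circuit v).incidenceSet x = F.incidenceSet x := by
      ext e
      simp [circuit_inc, hx']
    rw [this, hF x (K.orbit_subset v hx')]

lemma ncard_edgeSet_circuit [Finite V(G)] (v : V(G)) :
    E(K.circuit v).ncard = minimalPeriod K.next v := by
  have h : E(K.circuit v) = K.out '' {x | K.next.SameCycle v x} := by
    ext e
    constructor
    · rintro ⟨x, y, h, hx, hy⟩
      obtain ⟨u, rfl⟩ := K.out_surjective e h.edge_mem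
      refine ⟨u, ?_, rfl⟩
      obtain ⟨rfl, rfl⟩ | ⟨rfl, rfl⟩ := h.eq_and_eq_or_eq_and_eq (K.out_link u)
      · exact K.coe_mem_orbit.1 hx
      · exact K.coe_mem_orbit.1 hy
    · rintro ⟨x, hx, rfl⟩
      exact ⟨x, K.next x, K.out_link x, K.coe_mem_orbit.2 hx,
        K.coe_mem_orbit.2 (Perm.sameCycle_apply_right.2 hx)⟩
  rw [h, Set.ncard_image_of_injective _ K.out_injective, Perm.ncard_sameCycle]

/-- Both graphs are 2-regular, so `C` contains every `F`-edge at its vertices and is closed under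
`next`; connectedness keeps it inside one orbit. -/
lemma eq_circuit [Finite V(G)] (hF : F.IsRegular 2) {C : Graph α β} (hC : C ≤ F)
    (hcirc : C.IsCircuit) {v : V(G)} (hv : (v : α) ∈ V(C)) : C = K.circuit v := by
  have hinc {x : α} (hx : x ∈ V(C)) {e : β} (he : F.Inc e x) : C.Inc e x := by
    have h1 : C.incidenceSet x = F.incidenceSet x := by
      have h2 := hcirc.2 x hx
      have h3 := hF x (hC.vertexSet_mono hx)
      exact Set.Finite.eq_of_subset_of_encard_le (Set.finite_of_encard_eq_coe h2)
        (fun e he => Inc.mono hC he) (by rw [h2, h3])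
    have h4 : e ∈ F.incidenceSet x := he
    rw [← h1] at h4
    exact h4
  have hnext (x : V(G)) (hx : (x : α) ∈ V(C)) : (K.next x : α) ∈ V(C) := by
    obtain ⟨z, hz⟩ := hinc hx (K.out_link x).inc_left
    rw [← (hz.mono hC).right_unique (K.out_link x)]
    exact hz.right_mem
  have hV : V(C) = K.orbit v := by
    apply Set.Subset.antisymm
    · intro y hy
      have hr := hcirc.1.2 v hv y hy
      clear hy
      induction hr with
      | refl => exact K.coe_mem_orbit.2 (Perm.SameCycle.refl _ _)
      | tail _ h ih =>
        obtain ⟨e, he⟩ := h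
        exact K.mem_orbit_of_isLink (he.mono hC) ih
    · rintro _ ⟨x, hx, rfl⟩
      obtain ⟨k, -, rfl⟩ := Perm.SameCycle.exists_iterate_lt hx
      clear hx
      induction k with
      | zero => exact hv
      | succ k ih => rw [iterate_succ_apply']; exact hnext _ ih
  refine (Compatible.of_le_le hC (K.circuit_le v)).ext hV (Set.ext fun e => ⟨fun he => ?_, ?_⟩)
  · obtain ⟨x, y, h⟩ := exists_isLink_of_mem_edgeSet he
    exact ⟨x, y, h.mono hC, hV ▸ h.left_mem, hV ▸ h.right_mem⟩
  · rintro ⟨x, y, h, hx, -⟩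
    rw [← hV] at hx
    exact (hinc hx h.inc_left).edge_mem

/-- Links the count of negative edges to the oddness. Both sides are indexed by the predecessors of
base points of odd cycles, since an edge is named by its tail. -/
lemma ncard_negSet [Finite V(G)] (hF : F.IsRegular 2) {b : V(G) → V(G)} (hb : K.next.IsBase b) :
    (K.negSet b).ncard = F.oddCircuits.ncard := by
  let S : Set V(G) := {u | b (K.next u) = K.next u ∧ Odd (minimalPeriod K.next u)}
  have h1 : K.negSet b = K.out '' S := by
    ext e
    constructor
    · rintro ⟨u, h1, h2, h3⟩
      exact ⟨u, ⟨h1, h2⟩, h3⟩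
    · rintro ⟨u, ⟨h1, h2⟩, h3⟩
      exact ⟨u, h1, h2, h3⟩
  have horb (u v : V(G)) (h : K.next.SameCycle u v) : K.circuit u = K.circuit v := by
    have : K.orbit u = K.orbit v := by
      refine congrArg (Set.image Subtype.val) (Set.ext fun x => ⟨fun hx => h.symm.trans hx, fun hx => h.trans hx⟩)
    rw [circuit, circuit, this]
  have h2 : F.oddCircuits = K.circuit '' S := by
    ext C
    constructor
    · rintro ⟨hC, hcirc, hodd⟩
      obtain ⟨v, hv⟩ := hcirc.1.1
      have hvG : v ∈ V(G) := K.le.vertexSet_mono (hC.vertexSet_mono hv)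
      have hCv := K.eq_circuit hF hC hcirc (v := ⟨v, hvG⟩) hv
      have hs : K.next.SameCycle ⟨v, hvG⟩ (K.next.symm (b ⟨v, hvG⟩)) := by
        rw [← Perm.sameCycle_apply_right, Equiv.apply_symm_apply]
        exact hb.sameCycle _
      refine ⟨K.next.symm (b ⟨v, hvG⟩), ⟨?_, ?_⟩, ?_⟩
      · rw [Equiv.apply_symm_apply, hb.base_base]
      · rw [← hs.minimalPeriod_eq, ← ncard_edgeSet_circuit, ← hCv]
        exact hodd
      · rw [← horb _ _ hs, hCv]
    · rintro ⟨u, hu, rfl⟩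
      refine ⟨K.circuit_le u, K.isCircuit_circuit hF u, ?_⟩
      rw [ncard_edgeSet_circuit]
      exact hu.2
  rw [h1, h2, Set.ncard_image_of_injective _ K.out_injective]
  refine (Set.InjOn.ncard_image ?_).symm
  intro u hu v hv huv
  have h3 : (v : α) ∈ V(K.circuit u) := by
    rw [huv]
    exact K.coe_mem_orbit.2 (Perm.SameCycle.refl _ _)
  have h4 : K.next.SameCycle u v := K.coe_mem_orbit.1 h3
  apply K.next.injective
  rw [← hu.1, ← hv.1]
  exact hb.eq_of_sameCycle _ _ (Perm.sameCycle_apply_right.2 (Perm.sameCycle_apply_left.2 h4))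

/-- Each odd circuit of a 2-factor contains a negative edge of an antibalanced signature. -/
lemma exists_negSet_subset [Finite V(G)] {σ : β → ℤˣ} (hσ : G.IsAntibalanced σ) :
    ∃ b, K.next.IsBase b ∧ K.negSet b ⊆ G.negEdges σ := by
  classical
  obtain ⟨s, hs⟩ := hσ
  -- Prefer heads of negative edges as base points. An odd circuit has one, for otherwise `s` would
  -- alternate around it.
  obtain ⟨b, hb, hP, -⟩ := K.next.exists_isBase fun v => σ (K.out (K.next.symm v)) = -1
  refine ⟨b, hb, ?_⟩
  rintro _ ⟨u, hu, hodd, rfl⟩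
  refine ⟨(K.link u).edge_mem, ?_⟩
  have h1 := hP (K.next u) (by
    by_contra! hcon
    refine Nat.not_even_iff_odd.2 hodd
      (Perm.even_minimalPeriod_of_flip (s := fun v => decide (s v = 1)) fun w hw h => ?_)
    have h2 : σ (K.out w) ≠ -1 := by
      have := hcon (K.next w) (Perm.sameCycle_apply_right.2 (Perm.sameCycle_apply_left.2 hw))
      rwa [Equiv.symm_apply_apply] at this
    have h3 := hs _ _ _ (K.link w)
    rw [decide_eq_decide] at h
    rw [h3] at h2
    rcases Int.units_eq_one_or (s w) with h4 | h4 <;>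
      rcases Int.units_eq_one_or (s (K.next w)) with h5 | h5 <;> rw [h4, h5] at h h2 <;>
      revert h h2 <;> decide)
  rwa [hu, Equiv.symm_apply_apply] at h1

end Frame

end Graph

end

/-! ### Edge cuts and 2-factors avoiding a given edge -/

noncomputable section

open Equiv Function

namespace Graph

variable {α β : Type*}

/-- Deleting a perfect matching from a cubic graph leaves a 2-factor. -/
lemma IsRegular.isFactor_deleteEdges {G : Graph α β} (hcubic : G.IsRegular 3) {N : Set β}
    (hN : ∀ v ∈ V(G), ∃ e, G.Inc e v ∧ e ∈ N ∧ ∀ e', G.Inc e' v → e' ∈ N → e' = e) :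
    (G.deleteEdges N).IsFactor G 2 := by
  refine ⟨⟨deleteEdges_le, rfl⟩, fun v hv => ?_⟩
  obtain ⟨e, he, heN, hu⟩ := hN v hv
  have h1 : (G.deleteEdges N).incidenceSet v = G.incidenceSet v \ {e} := by
    ext e'
    simp only [mem_incidenceSet, deleteEdges_inc, Set.mem_sdiff, Set.mem_singleton_iff]
    refine and_congr_right fun h => not_congr ⟨hu e' h, ?_⟩
    rintro rfl
    exact heN
  have h2 := Set.encard_sdiff_singleton_add_one (s := G.incidenceSet v) (a := e) he
  rw [hcubic v hv] at h2
  rw [h1]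
  have h3 : (G.incidenceSet v \ {e}).encard + 1 = 2 + 1 := by
    rw [h2]; norm_num
  exact (ENat.add_left_injective_of_ne_top (by decide)) h3

section Cut

variable {G : Graph α β} (hE : E(G).Finite)

open Classical in
/-- The number of ends of `e` in `S`. -/
def endCount (G : Graph α β) (S : Finset α) (e : β) : ℕ := (S.filter (G.Inc e)).card

open Classical in
/-- The edges with exactly one end in `S`. -/
def cut (hE : E(G).Finite) (S : Finset α) : Finset β :=
  hE.toFinset.filter fun e => G.endCount S e = 1

lemma mem_cut {S : Finset α} {e : β} : e ∈ cut hE S ↔ e ∈ E(G) ∧ G.endCount S e = 1 := by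
  simp [cut]

open Classical in
lemma endCount_eq [G.Loopless] {S : Finset α} {e : β} {x y : α} (h : G.IsLink e x y) :
    G.endCount S e = (if x ∈ S then 1 else 0) + if y ∈ S then 1 else 0 := by
  have h1 : S.filter (G.Inc e) = S.filter (· = x) ∪ S.filter (· = y) := by
    ext v
    simp only [Finset.mem_filter, Finset.mem_union, ← and_or_left]
    refine and_congr_right fun _ => ⟨fun hv => hv.eq_or_eq_of_isLink h, ?_⟩
    rintro (rfl | rfl)
    · exact h.inc_left
    · exact h.inc_right
  rw [endCount, h1, Finset.card_union_of_disjoint]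
  · have hz (z : α) : (S.filter (· = z)).card = if z ∈ S then 1 else 0 := by
      split_ifs with h2
      · refine Finset.card_eq_one.2 ⟨z, Finset.ext fun w => ?_⟩
        rw [Finset.mem_filter, Finset.mem_singleton]
        exact ⟨fun h => h.2, fun h => ⟨h ▸ h2, h⟩⟩
      · refine Finset.card_eq_zero.2 (Finset.filter_eq_empty_iff.2 fun w hw h => h2 (h ▸ hw))
    rw [hz, hz]
  · rw [Finset.disjoint_filter]
    rintro v - rfl
    exact h.ne

lemma sum_endCount (hcubic : G.IsRegular 3) {S : Finset α} (hS : ∀ v ∈ S, v ∈ V(G)) :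
    ∑ e ∈ hE.toFinset, G.endCount S e = 3 * S.card := by
  classical
  simp only [endCount, Finset.card_filter]
  rw [Finset.sum_comm]
  have h (v : α) (hv : v ∈ S) : ∑ e ∈ hE.toFinset, (if G.Inc e v then 1 else 0) = 3 := by
    rw [← Finset.card_filter]
    have h1 := hcubic v (hS v hv)
    have h2 : G.incidenceSet v = ↑(hE.toFinset.filter fun e => G.Inc e v) := by
      ext e
      simp only [mem_incidenceSet, Finset.coe_filter, Set.Finite.mem_toFinset, Set.mem_ofPred_eq]
      exact ⟨fun h => ⟨h.edge_mem, h⟩, fun h => h.2⟩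
    rw [h2, Set.encard_coe_eq_coe_finsetCard] at h1
    exact_mod_cast h1
  rw [Finset.sum_congr rfl h, Finset.sum_const, smul_eq_mul, mul_comm]

/-- The edge `e` inside `S` uses 2 of the degree sum `3 * S.card` and contributes nothing to the
cut. -/
lemma card_cut_add_two_le [G.Loopless] (hcubic : G.IsRegular 3) {S : Finset α}
    (hS : ∀ v ∈ S, v ∈ V(G)) {e : β} {x y : α} (h : G.IsLink e x y) (hx : x ∈ S) (hy : y ∈ S) :
    (cut hE S).card + 2 ≤ 3 * S.card := by
  classical
  have he : G.endCount S e = 2 := by simp [endCount_eq h, hx, hy]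
  rw [← sum_endCount hE hcubic hS, cut, Finset.card_filter]
  have hmem : e ∈ hE.toFinset := by simpa using h.edge_mem
  rw [← Finset.add_sum_erase _ _ hmem, ← Finset.add_sum_erase _ _ hmem, he]
  have : ∑ a ∈ hE.toFinset.erase e, (if G.endCount S a = 1 then 1 else 0) ≤
      ∑ a ∈ hE.toFinset.erase e, G.endCount S a := by
    refine Finset.sum_le_sum fun a _ => ?_
    split_ifs with h1 <;> omega
  rw [if_neg (by norm_num)]
  omega

lemma odd_card_cut [G.Loopless] (hcubic : G.IsRegular 3) {S : Finset α}
    (hS : ∀ v ∈ S, v ∈ V(G)) (hodd : Odd S.card) : Odd (cut hE S).card := by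
  classical
  have h1 : Odd (∑ e ∈ hE.toFinset, G.endCount S e) := by
    rw [sum_endCount hE hcubic hS]
    exact Odd.mul (by decide) hodd
  rw [Finset.odd_sum_iff_odd_card_odd] at h1
  convert h1 using 2
  refine Finset.filter_congr fun e he => ?_
  obtain ⟨x, y, h⟩ := exists_isLink_of_mem_edgeSet (hE.mem_toFinset.1 he)
  rw [endCount_eq h]
  split_ifs <;> decide

/-- The cut has odd size by counting degrees, and a cut consisting of one edge would be a bridge. -/
lemma IsBridgeless.three_le_card_cut [G.Loopless] (hcubic : G.IsRegular 3) (hG : G.IsBridgeless)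
    {S : Finset α} (hS : ∀ v ∈ S, v ∈ V(G)) (hodd : Odd S.card) : 3 ≤ (cut hE S).card := by
  classical
  have h1 := odd_card_cut hE hcubic hS hodd
  have h2 : (cut hE S).card ≠ 1 := by
    intro h
    obtain ⟨e, he⟩ := Finset.card_eq_one.1 h
    have hmem : e ∈ cut hE S := by simp [he]
    rw [mem_cut] at hmem
    obtain ⟨x, y, hxy, hx, hy⟩ : ∃ x y, G.IsLink e x y ∧ x ∈ S ∧ y ∉ S := by
      obtain ⟨x, y, hxy⟩ := exists_isLink_of_mem_edgeSet hmem.1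
      have h3 := hmem.2
      rw [endCount_eq hxy] at h3
      by_cases hx : x ∈ S
      · refine ⟨x, y, hxy, hx, fun hy => ?_⟩
        simp [hx, hy] at h3
      · refine ⟨y, x, hxy.symm, ?_, hx⟩
        by_contra hy
        simp [hx, hy] at h3
    refine hG e ⟨x, y, hxy, fun hr => hy ?_⟩
    clear hxy hy
    induction hr with
    | refl => exact hx
    | tail _ hadj ih =>
      obtain ⟨e', he'⟩ := hadj
      rw [deleteEdges_isLink] at he'
      by_contra hcon
      have h5 : e' ∈ cut hE S := by
        rw [mem_cut, endCount_eq he'.1]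
        exact ⟨he'.1.edge_mem, by simp [ih, hcon]⟩
      rw [he] at h5
      exact he'.2 (by simpa using h5)
  obtain ⟨k, hk⟩ := h1
  omega

end Cut

/-- The simple graph underlying `G`, with the vertices `x` and `y` deleted. -/
def avoiding (G : Graph α β) [G.Loopless] (x y : α) :
    SimpleGraph {v // v ∈ V(G) ∧ v ≠ x ∧ v ≠ y} where
  Adj u v := G.Adj u v
  symm := ⟨fun _ _ h => h.symm⟩
  loopless := ⟨fun _ h => h.ne rfl⟩

/-- In a bridgeless cubic graph, the graph without the ends of an edge has a perfect matching. -/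
lemma IsBridgeless.exists_isPerfectMatching {G : Graph α β} [G.Loopless] (hV : V(G).Finite)
    (hE : E(G).Finite) (hcubic : G.IsRegular 3) (hG : G.IsBridgeless) (heven : Even V(G).ncard)
    {e : β} {x y : α} (hxy : G.IsLink e x y) :
    ∃ M : (G.avoiding x y).Subgraph, M.IsPerfectMatching := by
  classical
  have hfV : Finite V(G) := hV
  have hfin : Finite {v // v ∈ V(G) ∧ v ≠ x ∧ v ≠ y} :=
    Finite.of_injective (fun v => (⟨v.1, v.2.1⟩ : V(G))) fun u v h =>
      Subtype.ext (congrArg (fun z : V(G) => z.1) h)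
  rw [SimpleGraph.tutte]
  intro U hU
  rw [SimpleGraph.IsTutteViolator] at hU
  set H := ((⊤ : (G.avoiding x y).Subgraph).deleteVerts U).coe with hH
  let ι : ((⊤ : (G.avoiding x y).Subgraph).deleteVerts U).verts → α := fun v => v.1.1
  have hι : Injective ι := fun u v h => Subtype.ext (Subtype.ext h)
  let S : H.ConnectedComponent → Finset α := fun c => (c.supp.toFinite.toFinset).image ι
  have hS (c : H.ConnectedComponent) (v : α) : v ∈ S c ↔ ∃ u ∈ c.supp, ι u = v := by
    simp [S]
  have hScard (c : H.ConnectedComponent) : (S c).card = c.supp.ncard := by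
    rw [Finset.card_image_of_injective _ hι, Set.ncard_eq_toFinset_card _ c.supp.toFinite]
  -- Every odd component left by the Tutte violator `U` sends at least 3 edges to `T`. The edge `xy`
  -- lies inside `T`, so at most `3 * (|U| + 2) - 2` edges leave `T`, and there are at most `|U| +
  -- 1` odd components.
  let T : Finset α := insert x (insert y (U.toFinite.toFinset.image Subtype.val))
  have hT (v : α) : v ∈ T ↔ v = x ∨ v = y ∨ ∃ u ∈ U, u.1 = v := by
    simp [T]
  have hTcard : T.card = U.ncard + 2 := by
    rw [Finset.card_insert_of_notMem, Finset.card_insert_of_notMem,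
      Finset.card_image_of_injective _ Subtype.val_injective,
      Set.ncard_eq_toFinset_card _ U.toFinite]
    · simp
    · simp [hxy.ne]
  have hSV (c : H.ConnectedComponent) : ∀ v ∈ S c, v ∈ V(G) := by
    intro v hv
    obtain ⟨u, -, rfl⟩ := (hS c v).1 hv
    exact u.1.2.1
  have hTV : ∀ v ∈ T, v ∈ V(G) := by
    intro v hv
    obtain rfl | rfl | ⟨u, -, rfl⟩ := (hT v).1 hv
    · exact hxy.left_mem
    · exact hxy.right_mem
    · exact u.2.1
  have hST (c : H.ConnectedComponent) (v : α) (hv : v ∈ S c) : v ∉ T := by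
    obtain ⟨u, -, rfl⟩ := (hS c v).1 hv
    rw [hT]
    rintro (h | h | ⟨w, hw, h⟩)
    · exact u.1.2.2.1 h
    · exact u.1.2.2.2 h
    · have : w = u.1 := Subtype.ext h
      exact (by simpa using u.2 : u.1 ∉ U) (this ▸ hw)
  have hlink (c : H.ConnectedComponent) {f : β} (hf : f ∈ cut hE (S c)) :
      ∃ p q, G.IsLink f p q ∧ p ∈ S c ∧ q ∈ T := by
    obtain ⟨hfE, hf1⟩ := (mem_cut hE).1 hf
    obtain ⟨p, q, hpq, hp, hq⟩ : ∃ p q, G.IsLink f p q ∧ p ∈ S c ∧ q ∉ S c := by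
      obtain ⟨p, q, hpq⟩ := exists_isLink_of_mem_edgeSet hfE
      rw [endCount_eq hpq] at hf1
      by_cases hp : p ∈ S c
      · refine ⟨p, q, hpq, hp, fun hq => ?_⟩
        simp [hp, hq] at hf1
      · refine ⟨q, p, hpq.symm, ?_, hp⟩
        by_contra hq
        simp [hp, hq] at hf1
    refine ⟨p, q, hpq, hp, ?_⟩
    by_contra hqT
    rw [hT] at hqT
    push Not at hqT
    obtain ⟨hqx, hqy, hqU⟩ := hqT
    obtain ⟨u, hu, rfl⟩ := (hS c p).1 hp
    let q' : {v // v ∈ V(G) ∧ v ≠ x ∧ v ≠ y} := ⟨q, hpq.right_mem, hqx, hqy⟩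
    have hq' : q' ∉ U := fun h => hqU q' h rfl
    have huU : u.1 ∉ U := by simpa using u.2
    let w : ((⊤ : (G.avoiding x y).Subgraph).deleteVerts U).verts := ⟨q', by simpa using hq'⟩
    have hadj : H.Adj u w := by
      rw [hH, SimpleGraph.Subgraph.coe_adj, SimpleGraph.Subgraph.deleteVerts_adj]
      exact ⟨trivial, huU, trivial, hq', hpq.adj⟩
    refine hq ((hS c q).2 ⟨w, ?_, rfl⟩)
    rw [SimpleGraph.ConnectedComponent.mem_supp_iff] at hu ⊢
    rw [← hu]
    exact (SimpleGraph.ConnectedComponent.sound hadj.reachable).symm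
  let O : Finset H.ConnectedComponent := (Set.toFinite H.oddComponents).toFinset
  have hO : O.card = H.oddComponents.ncard := (Set.ncard_eq_toFinset_card _ _).symm
  have hdisj : (O : Set H.ConnectedComponent).PairwiseDisjoint fun c => cut hE (S c) := by
    intro c _ d _ hcd
    rw [Function.onFun, Finset.disjoint_left]
    intro f hfc hfd
    obtain ⟨p, q, hpq, hp, hq⟩ := hlink c hfc
    obtain ⟨p', q', hpq', hp', hq'⟩ := hlink d hfd
    obtain ⟨rfl, rfl⟩ | ⟨rfl, rfl⟩ := hpq.eq_and_eq_or_eq_and_eq hpq'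
    · obtain ⟨u, hu, rfl⟩ := (hS c _).1 hp
      obtain ⟨w, hw, hwu⟩ := (hS d _).1 hp'
      rw [hι hwu] at hw
      rw [SimpleGraph.ConnectedComponent.mem_supp_iff] at hu hw
      exact hcd (hu.symm.trans hw)
    · exact hST _ _ hp hq'
  have hsub : O.biUnion (fun c => cut hE (S c)) ⊆ cut hE T := by
    intro f hf
    obtain ⟨c, -, hfc⟩ := Finset.mem_biUnion.1 hf
    obtain ⟨p, q, hpq, hp, hq⟩ := hlink c hfc
    rw [mem_cut, endCount_eq hpq]
    exact ⟨hpq.edge_mem, by simp [hST c p hp, hq]⟩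
  have h1 : O.card * 3 ≤ (cut hE T).card := by
    refine le_trans ?_ (Finset.card_le_card hsub)
    rw [Finset.card_biUnion hdisj]
    rw [← smul_eq_mul]
    refine Finset.card_nsmul_le_sum _ _ _ fun c hc => ?_
    refine hG.three_le_card_cut hE hcubic (hSV c) ?_
    rw [hScard]
    simpa [O] using hc
  have h2 := card_cut_add_two_le hE hcubic hTV hxy ((hT x).2 (Or.inl rfl))
    ((hT y).2 (Or.inr (Or.inl rfl)))
  have hcard : Nat.card ((⊤ : (G.avoiding x y).Subgraph).deleteVerts U).verts + T.card =
      V(G).ncard := by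
    have hr : (Set.range ι).ncard =
        Nat.card ((⊤ : (G.avoiding x y).Subgraph).deleteVerts U).verts := by
      rw [← Set.image_univ, Set.ncard_image_of_injective _ hι, Set.ncard_univ]
    have hun : V(G) = Set.range ι ∪ (T : Set α) := by
      ext v
      constructor
      · intro hv
        by_cases hvT : v ∈ T
        · exact Or.inr hvT
        · left
          rw [hT] at hvT
          push Not at hvT
          exact ⟨⟨⟨v, hv, hvT.1, hvT.2.1⟩, by simpa using fun h => hvT.2.2 _ h rfl⟩, rfl⟩
      · rintro (⟨u, rfl⟩ | hv)
        · exact u.1.2.1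
        · exact hTV v hv
    have hdis : Disjoint (Set.range ι) (T : Set α) := by
      rw [Set.disjoint_left]
      rintro _ ⟨u, rfl⟩
      exact hST (H.connectedComponentMk u) _ ((hS _ _).2 ⟨u, rfl, rfl⟩)
    rw [← hr, ← Set.ncard_coe_finset T,
      ← Set.ncard_union_eq hdis (Set.finite_range ι) T.finite_toSet, ← hun]
  -- As `V(G)` is even, the number of odd components has the parity of `|U|`; exceeding `|U|`, it is
  -- at least `|U| + 2`.
  have hpar := SimpleGraph.odd_ncard_oddComponents H
  rw [← hO] at hU hpar
  rw [← hcard, hTcard] at heven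
  rw [hTcard] at h2
  rw [Nat.odd_iff, Nat.odd_iff] at hpar
  rw [Nat.even_iff] at heven
  omega

/-- In a bridgeless cubic graph, every edge is avoided by some 2-factor. -/
lemma IsBridgeless.exists_isFactor_notMem {G : Graph α β} [G.Loopless] (hV : V(G).Finite)
    (hE : E(G).Finite) (hcubic : G.IsRegular 3) (hG : G.IsBridgeless) (heven : Even V(G).ncard)
    {e : β} (he : e ∈ E(G)) : ∃ F : Graph α β, F.IsFactor G 2 ∧ e ∉ E(F) := by
  classical
  obtain ⟨x, y, hxy⟩ := exists_isLink_of_mem_edgeSet he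
  obtain ⟨M, hM⟩ := hG.exists_isPerfectMatching hV hE hcubic heven hxy
  -- Parallel edges require a choice. Making it on unordered pairs gives each matched pair one edge;
  -- `e` is only a default.
  have hch (z : Sym2 α) : ∃ f, ∀ u v, z = s(u, v) → G.Adj u v → G.IsLink f u v := by
    by_cases h : ∃ f u v, z = s(u, v) ∧ G.IsLink f u v
    · obtain ⟨f, u, v, rfl, hf⟩ := h
      refine ⟨f, fun u' v' h' _ => ?_⟩
      rw [Sym2.eq_iff] at h'
      obtain ⟨rfl, rfl⟩ | ⟨rfl, rfl⟩ := h'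
      · exact hf
      · exact hf.symm
    · exact ⟨e, fun u v h1 ⟨f, hf⟩ => absurd ⟨f, u, v, h1, hf⟩ h⟩
  choose ch hch using hch
  let N : Set β := insert e {f | ∃ u v, M.Adj u v ∧ f = ch s(u.1, v.1)}
  have hlink {u v} (h : M.Adj u v) : G.IsLink (ch s(u.1, v.1)) u.1 v.1 :=
    hch _ _ _ rfl h.adj_sub
  have hends {z : α} (hz : z = x ∨ z = y) (f : β) (hf : G.Inc f z) (hfN : f ∈ N) : f = e := by
    obtain rfl | ⟨u, v, huv, rfl⟩ := hfN
    · rfl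
    · exfalso
      obtain rfl | rfl := hf.eq_or_eq_of_isLink (hlink huv)
      · exact hz.elim u.2.2.1 u.2.2.2
      · exact hz.elim v.2.2.1 v.2.2.2
  refine ⟨G.deleteEdges N, hcubic.isFactor_deleteEdges fun v hv => ?_, fun h => ?_⟩
  · by_cases hvx : v = x
    · exact ⟨e, hvx ▸ hxy.inc_left, Set.mem_insert _ _, hends (Or.inl hvx)⟩
    by_cases hvy : v = y
    · exact ⟨e, hvy ▸ hxy.inc_right, Set.mem_insert _ _, hends (Or.inr hvy)⟩
    let v' : {v // v ∈ V(G) ∧ v ≠ x ∧ v ≠ y} := ⟨v, hv, hvx, hvy⟩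
    obtain ⟨w, hw, hwu⟩ := hM.1 (hM.2 v')
    refine ⟨ch s(v, w.1), (hlink hw).inc_left, Or.inr ⟨v', w, hw, rfl⟩, ?_⟩
    rintro f hf (rfl | ⟨p, q, hpq, rfl⟩)
    · exact ((hf.eq_or_eq_of_isLink hxy).elim hvx hvy).elim
    · obtain h1 | h1 := hf.eq_or_eq_of_isLink (hlink hpq)
      · obtain rfl : v' = p := Subtype.ext h1
        rw [hwu q hpq]
      · obtain rfl : v' = q := Subtype.ext h1
        rw [hwu p hpq.symm, Sym2.eq_swap]
  · exact h.2 (Set.mem_insert _ _)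

end Graph

end

/-! ### Minimal sets and the theorem -/

noncomputable section

namespace Graph

variable {α β : Type*}

lemma IsFactor.exists_two_factor {G M : Graph α β} (hcubic : G.IsRegular 3) (hM : M.IsFactor G 1) :
    ∃ F : Graph α β, F.IsFactor G 2 := by
  refine ⟨G.deleteEdges E(M), hcubic.isFactor_deleteEdges fun v hv => ?_⟩
  obtain ⟨e, he⟩ := Set.encard_eq_one.1 (hM.2 v (by rwa [hM.1.vertexSet_eq]))
  have hmem (e' : β) : M.Inc e' v ↔ e' = e := by
    rw [← mem_incidenceSet, he, Set.mem_singleton_iff]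
  have h1 : M.Inc e v := (hmem e).2 rfl
  exact ⟨e, h1.mono hM.1.le, h1.edge_mem, fun e' h2 h3 =>
    (hmem e').1 ((hM.1.le.inc_congr h3).2 h2)⟩

lemma oddness_le {G F : Graph α β} (hF : F.IsFactor G 2) : G.oddness ≤ F.oddCircuits.ncard :=
  Nat.sInf_le ⟨F, hF, rfl⟩

lemma IsFactor.exists_oddness_eq {G F : Graph α β} (hF : F.IsFactor G 2) :
    ∃ F' : Graph α β, F'.IsFactor G 2 ∧ F'.oddCircuits.ncard = G.oddness :=
  Nat.sInf_mem (s := {n | ∃ F : Graph α β, F.IsFactor G 2 ∧ F.oddCircuits.ncard = n}) ⟨_, F, hF, rfl⟩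

lemma Frame.circularFlowNumber_eq_four {G F : Graph α β} [G.Loopless] [Finite V(G)] (K : Frame G F)
    (hcubic : G.IsRegular 3) {b : V(G) → V(G)} (hb : K.next.IsBase b)
    (h : ¬ G.IsAntibalanced (signature (K.negSet b))) :
    G.circularFlowNumber (signature (K.negSet b)) = (4 : ℝ) ∧
      G.integerFlowNumber (signature (K.negSet b)) = (4 : ℝ) := by
  obtain ⟨f, hf, hint⟩ := K.exists_isNowhereZeroFlow hb
  have h1 : ((4 : ℝ) : EReal) ≤ G.circularFlowNumber (signature (K.negSet b)) := by
    by_contra! hlt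
    exact h (isAntibalanced_of_circularFlowNumber_lt hcubic hlt)
  have h2 : G.integerFlowNumber (signature (K.negSet b)) ≤ (4 : ℝ) :=
    sInf_le ⟨4, ⟨by norm_num, f, hf, hint⟩, rfl⟩
  have h3 := G.circularFlowNumber_le_integerFlowNumber (signature (K.negSet b))
  exact ⟨le_antisymm (h3.trans h2) h1, le_antisymm h2 (h1.trans h3)⟩

/-- Below every set of negative edges with circular flow number `r` there is an `r`-minimal set. -/
lemma exists_isMinimalSet {G : Graph α β} (hE : E(G).Finite) {r : ℝ} {σ : β → ℤˣ}
    (h : G.circularFlowNumber σ = r) : ∃ X, G.IsMinimalSet r X ∧ X ⊆ G.negEdges σ := by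
  obtain ⟨σ', ⟨h1, h2⟩, hmin⟩ := (measure fun σ' => (G.negEdges σ').ncard).wf.has_min
    {σ' | G.circularFlowNumber σ' = r ∧ G.negEdges σ' ⊆ G.negEdges σ} ⟨σ, h, subset_rfl⟩
  refine ⟨G.negEdges σ', ⟨⟨σ', h1, rfl⟩, fun σ'' hss h3 => ?_⟩, h2⟩
  exact hmin σ'' ⟨h3, hss.subset.trans h2⟩
    (Set.ncard_lt_ncard hss (hE.subset fun e he => he.1))

end Graph

end

theorem theorem5p3 {α β : Type*} (G : Graph α β) [G.Loopless]
    (hV : V(G).Finite) (hE : E(G).Finite)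
    (hcubic : G.IsRegular 3) (hbip : ¬ G.IsBipartite)
    (hfactor : ∃ M : Graph α β, M.IsFactor G 1) :
    (∃ σ : β → ℤˣ, (G.negEdges σ).ncard = G.oddness ∧
      G.circularFlowNumber σ = 4 ∧ G.integerFlowNumber σ = 4) ∧
    (G.IsBridgeless → ∀ X₃ : Set β, G.IsMinimalSet 3 X₃ →
      ∃ X₄ : Set β, G.IsMinimalSet 4 X₄ ∧ X₄ ⊂ X₃ ∧
        X₄.ncard ≤ G.oddness ∧ G.oddness < X₃.ncard) := by
  have hfin : Finite V(G) := hV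
  have hne : V(G).Nonempty := by
    by_contra hempty
    rw [Set.not_nonempty_iff_eq_empty] at hempty
    exact hbip ⟨fun _ => true, fun e x y h => by simpa [hempty] using h.left_mem⟩
  obtain ⟨M, hM⟩ := hfactor
  obtain ⟨F₀, hF₀⟩ := hM.exists_two_factor hcubic
  obtain ⟨F, hF, hodd⟩ := hF₀.exists_oddness_eq
  obtain ⟨K⟩ := hF.exists_frame hV hcubic
  refine ⟨?_, fun hbridge X₃ hX₃ => ?_⟩
  · obtain ⟨b, hb, hanti⟩ := K.exists_not_isAntibalanced hbip
    refine ⟨Graph.signature (K.negSet b), ?_, K.circularFlowNumber_eq_four hcubic hb hanti⟩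
    rw [Graph.negEdges_signature (K.negSet_subset_edgeSet b), K.ncard_negSet hF.2 hb, hodd]
  · obtain ⟨⟨σ, hσ, rfl⟩, hmin⟩ := hX₃
    have hanti : G.IsAntibalanced σ := by
      refine Graph.isAntibalanced_of_circularFlowNumber_lt hcubic ?_
      rw [hσ]
      exact EReal.coe_lt_coe_iff.2 (by norm_num)
    have hXfin : (G.negEdges σ).Finite := hE.subset fun e he => he.1
    obtain ⟨e, he⟩ : (G.negEdges σ).Nonempty := by
      by_contra hempty
      rw [Set.not_nonempty_iff_eq_empty] at hempty
      obtain ⟨s, hs⟩ := hanti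
      refine hbip ⟨fun x => decide (s x = 1), fun e x y hxy h => ?_⟩
      have h1 : σ e ≠ -1 := fun h2 => by
        have h3 : e ∈ G.negEdges σ := ⟨hxy.edge_mem, h2⟩
        simp [hempty] at h3
      rw [hs e x y hxy] at h1
      rw [decide_eq_decide] at h
      rcases Int.units_eq_one_or (s x) with h3 | h3 <;>
        rcases Int.units_eq_one_or (s y) with h4 | h4 <;> rw [h3, h4] at h h1 <;>
        revert h h1 <;> decide
    have heven : Even V(G).ncard := by
      have := even_ncard_of_involutive K.mate_involutive K.mate_ne (A := Set.univ)
        fun _ _ => trivial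
      rwa [Set.ncard_univ, Nat.card_coe_set_eq] at this
    have hlt : G.oddness < (G.negEdges σ).ncard := by
      -- Each odd circuit of `F'` contains an edge of `X₃`, and `e` is a further edge of `X₃`
      -- outside `F'`.
      obtain ⟨F', hF', heF'⟩ := hbridge.exists_isFactor_notMem hV hE hcubic heven he.1
      obtain ⟨K'⟩ := hF'.exists_frame hV hcubic
      obtain ⟨b, hb, hsub⟩ := K'.exists_negSet_subset hanti
      refine (Graph.oddness_le hF').trans_lt ?_
      rw [← K'.ncard_negSet hF'.2 hb]
      exact Set.ncard_lt_ncard ⟨hsub, fun h => heF' (K'.negSet_subset b (h he))⟩ hXfin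
    obtain ⟨b, hb, hsub⟩ := K.exists_negSet_subset hanti
    have hcard : (K.negSet b).ncard = G.oddness := by rw [K.ncard_negSet hF.2 hb, hodd]
    have hneg := Graph.negEdges_signature (K.negSet_subset_edgeSet b)
    have hss : K.negSet b ⊂ G.negEdges σ := by
      refine hsub.ssubset_of_ne fun h => ?_
      rw [← h, hcard] at hlt
      exact lt_irrefl _ hlt
    -- An antibalanced choice would have flow number 3 on a proper subset of `X₃`, against
    -- 3-minimality.
    have hnot : ¬ G.IsAntibalanced (Graph.signature (K.negSet b)) := fun h =>
      hmin _ (by rwa [hneg]) (h.circularFlowNumber_eq K hcubic hne)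
    obtain ⟨X₄, hX₄, hX₄sub⟩ :=
      Graph.exists_isMinimalSet hE (K.circularFlowNumber_eq_four hcubic hb hnot).1
    rw [hneg] at hX₄sub
    refine ⟨X₄, hX₄, hX₄sub.trans_ssubset hss, ?_, hlt⟩
    rw [← hcard]
    exact Set.ncard_le_ncard hX₄sub (hXfin.subset hsub)
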